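/- Let $m,q\ge 1$ and let $Y_r=([X_r^1],\dots,[X_r^q])$, $r=1,2,\dots$, with $X_r^s\in\mathbb R^{m+1}$, $(X_r^s)^TX_r^s=1$, be i.i.d. random objects on $(\mathbb RP^m)^q$. Let $S(m+1)$ be the space of real symmetric $(m+1)\times(m+1)$ matrices, let $S(m+1)^q$ carry the Euclidean (Frobenius) metric, and let $j_k:(\mathbb RP^m)^q\to S(m+1)^q$ be given by $j_k([x_1],\dots,[x_q])=(x_1x_1^T,\dots,x_qx_q^T)$ for unit vectors $x_s$. Assume that $Y_1$ is $j_k$-nonfocal, i.e. there is exactly one point $\mu_{j_k}\in(\mathbb RP^m)^q$ (the extrinsic mean) whose image under $j_k$ is nearest to $\mu=E[j_k(Y_1)]$. Write $\mu_{j_k}=([\nu_1],\dots,[\nu_q])$ with $\nu_s^T\nu_s=1$. For $s=1,\dots,q$ let $\lambda_s(1)\le\dots\le\lambda_s(m+1)$ be the eigenvalues and $\gamma_s(1),\dots,\gamma_s(m+1)$ corresponding orthonormal eigenvectors of $E[X_1^s(X_1^s)^T]$ (so that $\nu_s=\pm\gamma_s(m+1)$). Assume $\lambda_s(1)>0$ for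 every $s$, and assume that the extrinsic covariance matrix $\Sigma_E$ of $Y_1$ is positive definite. Here $\Sigma_E$ is the $mq\times mq$ covariance matrix of the coordinates of $d_\mu P(j_k(Y_1))$ in the basis $(e_{(s,a)})_{1\le s\le q,\,1\le a\le m}$ of the tangent space of $j_k((\mathbb RP^m)^q)$ at $P(\mu)$, where $P$ is the nearest-point projection onto $j_k((\mathbb RP^m)^q)$ and $e_{(s,a)}$ has $\gamma_s(a)\nu_s^T+\nu_s\gamma_s(a)^T$ as its $s$-th component and zero matrices elsewhere. For each $n$ let $d_s(1)\le\dots\le d_s(m+1)$ be the eigenvalues and $g_s(1),\dots,g_s(m+1)$ corresponding orthonormal eigenvectors, chosen measurably, of $J_s=n^{-1}\sum_{r=1}^nX_r^s(X_r^s)^T$, with the sign of $g_s(m+1)$ chosen so that $\nu_s^Tg_s(m+1)\ge 0$. Put $D_s=(g_s(1),\dots,g_s(m))$, let $G_n$ be the $mq\times mq$ matrix with entries $$(G_n)_{(s,a),(t,b)}=\frac{\sum_{r=1}^n (g_s(a)^TX_r^s)(g_t(b)^TX_r^t)(g_s(m+1)^TX_r^s)(g_t(m+1)^TX_r^t)}{n\,(d_s(m+1)-d_s(a))\,(d_t(m+1)-d_t(b))},$$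 and let $$T(\overline Y_{j_k,n};\mu_{j_k})=n\,(\nu_1^TD_1,\dots,\nu_q^TD_q)\,G_n^{-1}\,(\nu_1^TD_1,\dots,\nu_q^TD_q)^T,$$ where $T$ is set to $0$ on the event that $G_n$ is undefined or singular. Then, as $n\to\infty$, $T(\overline Y_{j_k,n};\mu_{j_k})$ converges weakly to a $\chi^2_{mq}$ distributed random variable. -/

import Mathlib

open MeasureTheory ProbabilityTheory Filter Topology
open scoped Matrix RealInnerProductSpace

namespace ProjectiveShape

noncomputable section

/-! ### Extrinsic means and extrinsic covariance for a map into a Euclidean space -/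

section Extrinsic

variable {M E : Type*} [NormedAddCommGroup E]

/-- `J p` is a point of `J(M)` at the smallest distance from `v`. -/
def IsNearest (J : M → E) (v : E) (p : M) : Prop :=
  ∀ p' : M, dist (J p) v ≤ dist (J p') v

/-- `v` is a nonfocal point of `J(M)`: exactly one point of `M` has its image nearest to `v`. -/
def IsNonfocal (J : M → E) (v : E) : Prop :=
  ∃! p : M, IsNearest J v p

/-- A point of `M` whose image is nearest to `v` (arbitrary if there is none). -/
def nearest [Nonempty M] (J : M → E) (v : E) : M :=
  Classical.epsilon (IsNearest J v)

/-- The projection `P_J` onto `J(M)`. -/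
def orthoProj [Nonempty M] (J : M → E) (v : E) : E :=
  J (nearest J v)

variable {Ω : Type*} [MeasurableSpace Ω]

/-- The mean vector `E(J(Y))`. -/
def meanVector [NormedSpace ℝ E] (J : M → E) (Y : Ω → M) (P : Measure Ω) : E :=
  ∫ ω, J (Y ω) ∂P

/-- The random object `Y` is `J`-nonfocal. -/
def NonfocalObject [NormedSpace ℝ E] (J : M → E) (Y : Ω → M) (P : Measure Ω) : Prop :=
  IsNonfocal J (meanVector J Y P)

/-- The extrinsic mean `J⁻¹ (P_J (E(J(Y))))`. -/
def extrinsicMean [NormedSpace ℝ E] [Nonempty M] (J : M → E) (Y : Ω → M) (P : Measure Ω) : M :=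
  nearest J (meanVector J Y P)

/-- The extrinsic covariance matrix of `Y` with respect to an orthogonal basis `e` of the tangent
space of `J(M)` at `P_J (μ)`, `μ = E(J(Y))`: the covariance matrix of the coordinates with respect
to `e` of the random tangent vector `d_μ P_J (J(Y))`. In matrix form it is `B Σ Bᵀ` with `Σ` the
covariance matrix of `J(Y)` and `B` the matrix of `d_μ P_J`.
(The coordinates do not depend on the scale of the inner product.) -/
def extrinsicCov [InnerProductSpace ℝ E] [Nonempty M] {ι : Type*}
    (J : M → E) (Y : Ω → M) (P : Measure Ω) (e : ι → E) : Matrix ι ι ℝ :=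
  let Z : ι → Ω → ℝ := fun i ω =>
    ⟪e i, fderiv ℝ (orthoProj J) (meanVector J Y P) (J (Y ω))⟫ / ⟪e i, e i⟫
  Matrix.of fun i k => cov[Z i, Z k; P]

end Extrinsic

/-! ### Real projective space and the embedding `j_k` -/

/-- The coordinate space `ℝ^(m+1)` with its Euclidean norm. -/
abbrev Vec (m : ℕ) : Type := EuclideanSpace ℝ (Fin (m + 1))

/-- The real projective space of dimension `m`. -/
abbrev RP (m : ℕ) : Type := Projectivization ℝ (Vec m)

/-- The quotient topology of the space of nonzero vectors. -/
instance instTopologicalSpaceRP (m : ℕ) : TopologicalSpace (RP m) :=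
  TopologicalSpace.coinduced (fun v : {v : Vec m // v ≠ 0} => Projectivization.mk' ℝ v)
    inferInstance

/-- The Borel σ-algebra of the projective space. -/
instance instMeasurableSpaceRP (m : ℕ) : MeasurableSpace (RP m) := borel (RP m)

/-- `p = [x]` with `xᵀ x = 1`. -/
def IsUnitRep {m : ℕ} (x : Vec m) (p : RP m) : Prop :=
  ‖x‖ = 1 ∧ ∃ h : x ≠ 0, Projectivization.mk ℝ x h = p

/-- The entries of `j([x]) = x xᵀ`, `xᵀ x = 1`, written with an arbitrary representative. -/
def jEntry {m : ℕ} (p : RP m) (a b : Fin (m + 1)) : ℝ :=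
  p.rep a * p.rep b / ‖p.rep‖ ^ 2

theorem jEntry_eq {m : ℕ} {x : Vec m} {p : RP m} (h : IsUnitRep x p) (a b : Fin (m + 1)) :
    jEntry p a b = x a * x b := by
  obtain ⟨hx, h0, rfl⟩ := h
  obtain ⟨c, hc⟩ := Projectivization.exists_smul_eq_mk_rep ℝ x h0
  have hc0 : (c : ℝ) ≠ 0 := c.ne_zero
  have hc' : (Projectivization.mk ℝ x h0).rep = (c : ℝ) • x := hc.symm
  rw [jEntry, hc', norm_smul, hx, mul_one, Real.norm_eq_abs, sq_abs]
  simp only [PiLp.smul_apply, smul_eq_mul]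
  field_simp

/-- The `q`-tuples of symmetric `(m+1) × (m+1)` matrices, `S(m+1)^q`, with the Euclidean
(Frobenius) inner product. -/
abbrev SymTuple (q m : ℕ) : Submodule ℝ
    (EuclideanSpace ℝ (Fin q × Fin (m + 1) × Fin (m + 1))) where
  carrier := {A | ∀ s a b, A (s, a, b) = A (s, b, a)}
  add_mem' := fun hA hB s a b => by simp [hA s a b, hB s a b]
  zero_mem' := fun s a b => by simp
  smul_mem' := fun c A hA s a b => by simp [hA s a b]

/-- The embedding `j_k ([x_1], …, [x_q]) = (x_1 x_1ᵀ, …, x_q x_qᵀ)`, the `x_s` unit vectors. -/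
def jk {q m : ℕ} (p : Fin q → RP m) : SymTuple q m :=
  ⟨WithLp.toLp 2 fun i => jEntry (p i.1) i.2.1 i.2.2,
    fun s a b => by simp [jEntry, mul_comm]⟩

/-- The tangent vector `e_(s,a) = d j_k (f_(s,a))` at `j_k ([ν_1], …, [ν_q])`, where `f_(s,a)` has
`w s a`, a vector orthogonal to `ν_s`, in position `s` and zeros elsewhere: its component in
position `s` is `(w s a) ν_sᵀ + ν_s (w s a)ᵀ`, the other components vanish. -/
def tangentFrame {q m : ℕ} (ν : Fin q → Vec m) (w : Fin q → Fin m → Vec m)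
    (k : Fin q × Fin m) : SymTuple q m :=
  ⟨WithLp.toLp 2 fun i =>
      if i.1 = k.1 then
        w k.1 k.2 i.2.1 * ν k.1 i.2.2 + ν k.1 i.2.1 * w k.1 k.2 i.2.2
      else 0,
    fun s a b => by
      by_cases h : s = k.1
      · simp [h]; ring
      · simp [h]⟩

/-! ### Sample quantities -/

/-- `d` lists the eigenvalues of `A` in increasing order, with multiplicities, and `g` is a
corresponding orthonormal basis of eigenvectors. -/
def IsOrderedEigensystem {m : ℕ} (A : Matrix (Fin (m + 1)) (Fin (m + 1)) ℝ)
    (d : Fin (m + 1) → ℝ) (g : OrthonormalBasis (Fin (m + 1)) ℝ (Vec m)) : Prop :=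
  Monotone d ∧ ∀ a, Matrix.toEuclideanLin A (g a) = d a • g a

/-- `E (X Xᵀ)`. -/
def secondMoment {Ω : Type*} [MeasurableSpace Ω] {m : ℕ} (P : Measure Ω) (X : Ω → Vec m) :
    Matrix (Fin (m + 1)) (Fin (m + 1)) ℝ :=
  Matrix.of fun a b => ∫ ω, X ω a * X ω b ∂P

/-- `J_s = n⁻¹ ∑_r x_r^s (x_r^s)ᵀ`, the sum over the first `n` observations. -/
def sampleMoment {q m : ℕ} (n : ℕ) (x : ℕ → Fin q → Vec m) (s : Fin q) :
    Matrix (Fin (m + 1)) (Fin (m + 1)) ℝ :=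
  Matrix.of fun a b => (n : ℝ)⁻¹ * ∑ r ∈ Finset.range n, x r s a * x r s b

/-- The extrinsic sample covariance matrix `G_n`, computed from the eigenvalues `d_s(a)` and the
eigenvectors `g_s(a)` of the matrices `J_s`. -/
def sampleCov {q m : ℕ} (n : ℕ) (x : ℕ → Fin q → Vec m) (d : Fin q → Fin (m + 1) → ℝ)
    (g : Fin q → OrthonormalBasis (Fin (m + 1)) ℝ (Vec m)) :
    Matrix (Fin q × Fin m) (Fin q × Fin m) ℝ :=
  Matrix.of fun i k =>
    (n : ℝ)⁻¹ * (d i.1 (Fin.last m) - d i.1 i.2.castSucc)⁻¹ *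
      (d k.1 (Fin.last m) - d k.1 k.2.castSucc)⁻¹ *
      ∑ r ∈ Finset.range n,
        ⟪g i.1 i.2.castSucc, x r i.1⟫ * ⟪g k.1 k.2.castSucc, x r k.1⟫ *
          ⟪g i.1 (Fin.last m), x r i.1⟫ * ⟪g k.1 (Fin.last m), x r k.1⟫

/-- The row vector `(ν_1ᵀ D_1, …, ν_qᵀ D_q)`, `D_s = (g_s(1), …, g_s(m))`. -/
def deviation {q m : ℕ} (g : Fin q → OrthonormalBasis (Fin (m + 1)) ℝ (Vec m))
    (ν : Fin q → Vec m) (i : Fin q × Fin m) : ℝ :=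
  ⟪ν i.1, g i.1 i.2.castSucc⟫

/-- The Hotelling `T²` type statistic
`n (ν_1ᵀ D_1, …, ν_qᵀ D_q) G_n⁻¹ (ν_1ᵀ D_1, …, ν_qᵀ D_q)ᵀ`. -/
def hotelling {q m : ℕ} (n : ℕ) (x : ℕ → Fin q → Vec m) (d : Fin q → Fin (m + 1) → ℝ)
    (g : Fin q → OrthonormalBasis (Fin (m + 1)) ℝ (Vec m)) (ν : Fin q → Vec m) : ℝ :=
  n * (deviation g ν ⬝ᵥ ((sampleCov n x d g)⁻¹ *ᵥ deviation g ν))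

/-- The chi-square distribution with `k` degrees of freedom: the law of the sum of the squares of
`k` independent standard normal variables. -/
def chiSq (k : ℕ) : Measure ℝ :=
  (Measure.pi fun _ : Fin k => gaussianReal 0 1).map fun z => ∑ i, z i ^ 2

instance instIsProbabilityMeasureChiSq (k : ℕ) : IsProbabilityMeasure (chiSq k) :=
  Measure.isProbabilityMeasure_map (Measurable.aemeasurable (by fun_prop))

end

end ProjectiveShape

namespace ProjectiveShape

/-! ### Central limit theorem, Gaussian quadratic forms and Slutsky's theorem -/

section Probability

variable {Ω : Type*} [MeasurableSpace Ω] {P : Measure Ω} {ι : Type*} [Fintype ι]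

/-! The lower eigenvalues may be repeated, so the sample eigenvectors $g_s(a)$, $a\le m$, need not
converge, and $G_n$ need not either. But $v^TG^{-1}v$ is unchanged under $v\mapsto Qv$, $G\mapsto
QGQ^T$. Take for $Q$ the block matrix with entries $\gamma_s(b)^Tg_s(a)\,(d_s(m+1)-d_s(a))$
(`changeFrame`). Since $\gamma_s(b)\perp\nu_s$, the spectral expansion of $J_s$ shows that $Q$ sends
the deviation vector exactly to minus the sample mean of the scores $(\gamma_s(b)^TX^s)(\nu_s^TX^s)$
(`changeFrame_mulVec_deviation`). It sends $G_n$ to an empirical second moment matrix that involves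
the sample eigenvectors only through $g_s(m+1)$ (`scoreCov_eq`). So `hotelling_eq` is an identity,
with no linearization error.

Nonfocality says that the top eigenvalue of each block is simple, hence $g_s(m+1)\to\nu_s$ almost
surely (`tendsto_of_rayleigh_max`), and the new matrix converges to the second moment matrix
$\Sigma$ of the scores (`tendsto_scoreCov`). The scores are bounded and centered, because
$\gamma_s(b)$ and $\nu_s$ are orthogonal eigenvectors of the population matrix, so their normalized
sums tend to $N(0,\Sigma)$.

Differentiating the projection gives $\Sigma_E=C\Sigma C$, with $C$ diagonal and made of inverse
eigenvalue gaps (`inner_tangentFrame_fderiv`, `scoreSigma_posDef`); thus $\Sigma$ is positive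
definite. Slutsky's theorem then yields the law of $z^T\Sigma^{-1}z$ for $z\sim N(0,\Sigma)$, which
is chi-square (`tendstoInDistribution_chiSq`). -/

theorem charFun_map_eq_charFun_map_inner {E : Type*} [NormedAddCommGroup E]
    [InnerProductSpace ℝ E] [MeasurableSpace E] [BorelSpace E] [SecondCountableTopology E]
    {V : Ω → E} (hV : AEMeasurable V P) (t : E) :
    charFun (P.map V) t = charFun (P.map fun ω => ⟪V ω, t⟫) 1 := by
  rw [charFun_apply, charFun_apply, integral_map hV (by fun_prop),
    integral_map (by fun_prop) (by fun_prop)]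
  simp

theorem secondMoment_posSemidef {V : Ω → EuclideanSpace ℝ ι} (hV : MemLp V 2 P) :
    (Matrix.of fun i j => ∫ ω, V ω i * V ω j ∂P).PosSemidef ∧
      ∀ t : EuclideanSpace ℝ ι, ∫ ω, ⟪V ω, t⟫ ^ 2 ∂P =
        t.ofLp ⬝ᵥ (Matrix.of fun i j => ∫ ω, V ω i * V ω j ∂P) *ᵥ t.ofLp := by
  have hcoord : ∀ i, MemLp (fun ω => V ω i) 2 P := fun i =>
    (EuclideanSpace.proj (𝕜 := ℝ) i).comp_memLp' hV
  have hint : ∀ i j, Integrable (fun ω => V ω i * V ω j) P := fun i j =>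
    (hcoord i).integrable_mul (hcoord j)
  have key : ∀ t : EuclideanSpace ℝ ι, ∫ ω, ⟪V ω, t⟫ ^ 2 ∂P =
      t.ofLp ⬝ᵥ (Matrix.of fun i j => ∫ ω, V ω i * V ω j ∂P) *ᵥ t.ofLp := by
    intro t
    have h : ∀ ω, ⟪V ω, t⟫ ^ 2 = ∑ i, ∑ j, t i * t j * (V ω i * V ω j) := by
      intro ω
      rw [PiLp.inner_apply, sq, Finset.sum_mul_sum]
      refine Finset.sum_congr rfl fun i _ => Finset.sum_congr rfl fun j _ => ?_
      simp only [RCLike.inner_apply, conj_trivial]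
      ring
    simp_rw [h]
    rw [integral_finsetSum _ fun i _ => integrable_finsetSum _ fun j _ =>
      (hint i j).const_mul _]
    simp only [dotProduct, Matrix.mulVec, Matrix.of_apply, Finset.mul_sum]
    refine Finset.sum_congr rfl fun i _ => ?_
    rw [integral_finsetSum _ fun j _ => (hint i j).const_mul _]
    refine Finset.sum_congr rfl fun j _ => ?_
    rw [integral_const_mul]
    ring
  refine ⟨Matrix.PosSemidef.of_dotProduct_mulVec_nonneg ?_ fun x => ?_, key⟩
  · ext i j
    simp [mul_comm]
  · have := key (WithLp.toLp 2 x)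
    simp only at this
    simp only [star_trivial]
    rw [← this]
    exact integral_nonneg fun ω => sq_nonneg _

/-- The central limit theorem in finite dimension for centered random vectors. -/
theorem tendstoInDistribution_multivariateGaussian [IsProbabilityMeasure P] [DecidableEq ι]
    {V : ℕ → Ω → EuclideanSpace ℝ ι}
    (hV : MemLp (V 0) 2 P) (h0 : ∀ i, ∫ ω, V 0 ω i ∂P = 0) (hindep : iIndepFun V P)
    (hident : ∀ k, IdentDistrib (V k) (V 0) P P) :
    TendstoInDistribution (fun (n : ℕ) ω => (√n)⁻¹ • ∑ k ∈ Finset.range n, V k ω) atTop id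
      (fun _ => P) (multivariateGaussian 0 (Matrix.of fun i j => ∫ ω, V 0 ω i * V 0 ω j ∂P)) := by
  obtain ⟨hpsd, hquad⟩ := secondMoment_posSemidef hV
  set S : Matrix ι ι ℝ := Matrix.of fun i j => ∫ ω, V 0 ω i * V 0 ω j ∂P
  have hm : ∀ n, AEMeasurable (fun ω => (√(n : ℕ))⁻¹ • ∑ k ∈ Finset.range n, V k ω) P := fun n =>
    (Finset.aemeasurable_fun_sum _ fun _ _ => (hident _).aemeasurable_fst).const_smul (√n)⁻¹
  refine ⟨hm, aemeasurable_id, ProbabilityMeasure.tendsto_iff_tendsto_charFun.2 fun t => ?_⟩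
  have hmean : ∫ ω, ⟪V 0 ω, t⟫ ∂P = 0 := by
    simp_rw [PiLp.inner_apply]
    rw [integral_finsetSum _ fun i _ => ?_]
    · refine Finset.sum_eq_zero fun i _ => ?_
      simp only [RCLike.inner_apply, conj_trivial]
      rw [integral_const_mul, h0, mul_zero]
    · simp only [RCLike.inner_apply, conj_trivial]
      exact (((EuclideanSpace.proj (𝕜 := ℝ) i).comp_memLp' hV).integrable one_le_two).const_mul _
  have hlp : MemLp (fun ω => ⟪V 0 ω, t⟫) 2 P := by
    have := (innerSL ℝ t).comp_memLp' hV
    simpa [Function.comp_def, real_inner_comm] using this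
  have hvar : Var[fun ω => ⟪V 0 ω, t⟫; P] = t.ofLp ⬝ᵥ S *ᵥ t.ofLp := by
    rw [variance_of_integral_eq_zero hlp.aemeasurable hmean, ← hquad]
  -- Cramér–Wold: the scalar theorem for the projection on `t`, read at frequency 1, gives the
  -- vector characteristic function at `t`.
  have hclt := tendstoInDistribution_inv_sqrt_mul_sum_sub (P := P)
    (X := fun k ω => ⟪V k ω, t⟫) (Y := id)
    (P' := gaussianReal 0 (Var[fun ω => ⟪V 0 ω, t⟫; P]).toNNReal)
    ⟨aemeasurable_id, by simp⟩ hlp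
    (hindep.comp (fun _ x => ⟪x, t⟫) fun _ => by fun_prop)
    (fun k => (hident k).comp (u := fun x => ⟪x, t⟫) (by fun_prop))
  have hlim := ProbabilityMeasure.tendsto_iff_tendsto_charFun.1 hclt.tendsto 1
  simp only [ProbabilityMeasure.coe_mk, Measure.map_id, hmean, mul_zero, sub_zero] at hlim ⊢
  rw [charFun_multivariateGaussian hpsd]
  rw [charFun_gaussianReal, hvar, Real.coe_toNNReal _ (by
    simpa using hpsd.dotProduct_mulVec_nonneg t.ofLp)] at hlim
  have hfun : (fun n : ℕ => charFun (P.map fun ω => (√n)⁻¹ • ∑ k ∈ Finset.range n, V k ω) t) =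
      fun n : ℕ => charFun (P.map fun ω => (√n)⁻¹ * ∑ k ∈ Finset.range n, ⟪V k ω, t⟫) 1 := by
    funext n
    rw [charFun_map_eq_charFun_map_inner (hm n)]
    simp_rw [real_inner_smul_left, sum_inner]
  rw [hfun]
  simpa using hlim

theorem map_sum_sq_stdGaussian :
    (stdGaussian (EuclideanSpace ℝ ι)).map (fun z => ∑ i, z i ^ 2) = chiSq (Fintype.card ι) := by
  rw [← map_pi_eq_stdGaussian, Measure.map_map (by fun_prop) (by fun_prop), chiSq]
  have e := Fintype.equivFin ι
  have h := measurePreserving_piCongrLeft (fun _ : Fin (Fintype.card ι) => gaussianReal 0 1) e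
  rw [← h.map_eq, Measure.map_map (by fun_prop) h.measurable]
  congr 1
  funext z
  simp only [Function.comp_apply]
  refine Fintype.sum_equiv e _ _ fun i => ?_
  congr 1
  exact (MeasurableEquiv.piCongrLeft_apply_apply (β := fun _ => ℝ) e z i).symm

open scoped MatrixOrder Matrix.Norms.L2Operator in
/-- The quadratic form of the inverse covariance matrix has a chi-square law. -/
theorem map_quadratic_multivariateGaussian [DecidableEq ι] {S : Matrix ι ι ℝ} (hS : S.PosDef) :
    (multivariateGaussian 0 S).map (fun x => x.ofLp ⬝ᵥ (S⁻¹ *ᵥ x.ofLp)) =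
      chiSq (Fintype.card ι) := by
  rw [multivariateGaussian, Measure.map_map (by fun_prop) (by fun_prop),
    ← map_sum_sq_stdGaussian]
  congr 1
  funext z
  -- With `R` the square root of `S`, the Gaussian vector is `R z` for a standard `z`, and `R S⁻¹ R
  -- = 1` turns the form into the sum of the `z i ^ 2`.
  have hsq : CFC.sqrt S * CFC.sqrt S = S := CFC.sqrt_mul_sqrt_self S hS.posSemidef.nonneg
  have hher : (CFC.sqrt S)ᵀ = CFC.sqrt S := by
    have := (Matrix.nonneg_iff_posSemidef.1 (CFC.sqrt_nonneg S)).isHermitian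
    simpa [Matrix.IsHermitian] using this
  have hdet : IsUnit (CFC.sqrt S).det := by
    have h1 : (CFC.sqrt S).det * (CFC.sqrt S).det = S.det := by rw [← Matrix.det_mul, hsq]
    have h2 := hS.det_pos
    rw [isUnit_iff_ne_zero]
    rintro h
    rw [h] at h1
    simp at h1
    linarith
  have hid : CFC.sqrt S * S⁻¹ * CFC.sqrt S = 1 := by
    rw [← hsq, Matrix.mul_inv_rev, hsq, ← Matrix.mul_assoc, Matrix.mul_nonsing_inv _ hdet,
      Matrix.one_mul, Matrix.nonsing_inv_mul _ hdet]
  simp only [Function.comp_apply, zero_add, Matrix.ofLp_toEuclideanCLM]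
  rw [Matrix.mulVec_mulVec]
  nth_rewrite 1 [← hher]
  rw [Matrix.mulVec_transpose, ← Matrix.dotProduct_mulVec, Matrix.mulVec_mulVec,
    ← Matrix.mul_assoc, hid, Matrix.one_mulVec]
  simp [dotProduct, sq]

/-- By Cramer's formula the entries are polynomials times the inverse of the determinant; the value
0 at singular matrices keeps this measurable everywhere. -/
theorem measurable_matrix_inv [DecidableEq ι] {K : Ω → Matrix ι ι ℝ}
    (hK : ∀ i j, Measurable fun ω => K ω i j) (i j : ι) : Measurable fun ω => (K ω)⁻¹ i j := by
  have hdet : ∀ {A : Ω → Matrix ι ι ℝ}, (∀ i j, Measurable fun ω => A ω i j) →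
      Measurable fun ω => (A ω).det := by
    intro A hA
    simp only [Matrix.det_apply]
    refine Finset.measurable_fun_sum _ fun σ _ => ?_
    refine Measurable.const_smul (Finset.measurable_fun_prod _ fun k _ => hA _ _) _
  simp only [Matrix.inv_def, Matrix.smul_apply, Ring.inverse_eq_inv', smul_eq_mul,
    Matrix.adjugate_apply]
  refine (hdet hK).inv.mul (hdet fun a b => ?_)
  simp only [Matrix.updateRow_apply]
  split_ifs
  · exact measurable_const
  · exact hK a b

theorem tendsto_matrix_inv [DecidableEq ι] {K : ℕ → Matrix ι ι ℝ} {S : Matrix ι ι ℝ}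
    (hK : Tendsto K atTop (𝓝 S)) (hS : S.det ≠ 0) : Tendsto (fun n => (K n)⁻¹) atTop (𝓝 S⁻¹) := by
  simp only [Matrix.inv_def, Ring.inverse_eq_inv']
  have h1 : Tendsto (fun n => (K n).det) atTop (𝓝 S.det) :=
    (Continuous.matrix_det continuous_id).continuousAt.tendsto.comp hK
  have h2 : Tendsto (fun n => (K n).adjugate) atTop (𝓝 S.adjugate) :=
    (Continuous.matrix_adjugate continuous_id).continuousAt.tendsto.comp hK
  exact (h1.inv₀ hS).smul h2

/-- Convergence of a studentized quadratic form to a chi-square law. -/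
theorem tendstoInDistribution_chiSq [IsProbabilityMeasure P] [DecidableEq ι] {S : Matrix ι ι ℝ} (hS : S.PosDef)
    {V : ℕ → Ω → EuclideanSpace ℝ ι} {K : ℕ → Ω → Matrix ι ι ℝ} {T : ℕ → Ω → ℝ} {k : ℕ}
    (hk : Fintype.card ι = k)
    (hV : TendstoInDistribution V atTop id (fun _ => P) (multivariateGaussian 0 S))
    (hKmeas : ∀ n i j, Measurable fun ω => K n ω i j)
    (hK : ∀ᵐ ω ∂P, Tendsto (fun n => K n ω) atTop (𝓝 S))
    (hTmeas : ∀ n, AEMeasurable (T n) P)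
    (hT : ∀ᵐ ω ∂P, ∀ᶠ n in atTop, T n ω = (V n ω).ofLp ⬝ᵥ ((K n ω)⁻¹ *ᵥ (V n ω).ofLp)) :
    TendstoInDistribution T atTop (id : ℝ → ℝ) (fun _ => P) (chiSq k) := by
  subst hk
  let L : ℕ → Ω → ι → ι → ℝ := fun n ω i j => (K n ω)⁻¹ i j
  have hLmeas : ∀ n, Measurable (L n) := fun n =>
    measurable_pi_lambda _ fun i => measurable_pi_lambda _ fun j =>
      measurable_matrix_inv (hKmeas n) i j
  have hL : TendstoInMeasure P L atTop fun _ => (fun i j => S⁻¹ i j) := by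
    refine tendstoInMeasure_of_tendsto_ae (fun n => (hLmeas n).aestronglyMeasurable) ?_
    filter_upwards [hK] with ω hω
    exact tendsto_matrix_inv hω hS.det_pos.ne'
  -- Slutsky: the inverse matrices converge in measure to a constant, and the quadratic form is
  -- jointly continuous.
  have hmain := hV.continuous_comp_prodMk_of_tendstoInMeasure_const
    (g := fun p : EuclideanSpace ℝ ι × (ι → ι → ℝ) => ∑ i, p.1 i * ∑ j, p.2 i j * p.1 j)
    (by fun_prop) hL fun n => (hLmeas n).aemeasurable
  have hlaw : TendstoInDistribution
      (fun n ω => (V n ω).ofLp ⬝ᵥ ((K n ω)⁻¹ *ᵥ (V n ω).ofLp)) atTop (id : ℝ → ℝ)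
      (fun _ => P) (chiSq (Fintype.card ι)) := by
    refine ⟨hmain.forall_aemeasurable, aemeasurable_id, ?_⟩
    have hlim : (chiSq (Fintype.card ι)).map id = (multivariateGaussian 0 S).map
        fun x => ∑ i, x i * ∑ j, S⁻¹ i j * x j := by
      rw [Measure.map_id, ← map_quadratic_multivariateGaussian hS]
      rfl
    have h := hmain.tendsto
    refine Tendsto.mono_right h (le_of_eq (congrArg 𝓝 ?_))
    exact Subtype.ext hlim.symm
  -- Almost surely `T n` equals the quadratic form for all large `n`, so the difference tends to 0
  -- in measure.
  refine tendstoInDistribution_of_tendstoInMeasure_sub T id hlaw ?_ hTmeas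
  refine tendstoInMeasure_of_tendsto_ae (fun n =>
    ((hTmeas n).sub (hlaw.forall_aemeasurable n)).aestronglyMeasurable) ?_
  filter_upwards [hT] with ω hω
  refine tendsto_const_nhds.congr' ?_
  filter_upwards [hω] with n hn
  simp [hn]

end Probability

/-! ### Rayleigh quotients and stability of a simple top eigenvalue -/

section EigenvectorPerturbation

variable {m : ℕ}

/-- The bilinear form `xᵀ A y`. -/
noncomputable def bform (A : Matrix (Fin (m + 1)) (Fin (m + 1)) ℝ) (x y : Vec m) : ℝ :=
  ⟪x, Matrix.toEuclideanLin A y⟫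

theorem bform_eq_sum (A : Matrix (Fin (m + 1)) (Fin (m + 1)) ℝ) (x y : Vec m) :
    bform A x y = ∑ a, ∑ b, x a * A a b * y b := by
  simp only [bform, PiLp.inner_apply, RCLike.inner_apply, conj_trivial, Matrix.ofLp_toLpLin,
    Matrix.toLin'_apply, Matrix.mulVec, dotProduct, Finset.sum_mul]
  exact Finset.sum_congr rfl fun a _ => Finset.sum_congr rfl fun b _ => by ring

theorem bform_comm {A : Matrix (Fin (m + 1)) (Fin (m + 1)) ℝ} (hA : A.IsSymm) (x y : Vec m) :
    bform A x y = bform A y x := by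
  rw [bform_eq_sum, bform_eq_sum, Finset.sum_comm]
  exact Finset.sum_congr rfl fun a _ => Finset.sum_congr rfl fun b _ => by
    rw [← hA.apply a b]; ring

/-- Coordinates of unit vectors are at most 1 in absolute value, so entrywise closeness controls the
forms uniformly on the sphere. -/
theorem abs_bform_sub_le (A B : Matrix (Fin (m + 1)) (Fin (m + 1)) ℝ) {x y : Vec m}
    (hx : ‖x‖ = 1) (hy : ‖y‖ = 1) :
    |bform A x y - bform B x y| ≤ ∑ a, ∑ b, |A a b - B a b| := by
  rw [bform_eq_sum, bform_eq_sum, ← Finset.sum_sub_distrib]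
  refine (Finset.abs_sum_le_sum_abs _ _).trans (Finset.sum_le_sum fun a _ => ?_)
  rw [← Finset.sum_sub_distrib]
  refine (Finset.abs_sum_le_sum_abs _ _).trans (Finset.sum_le_sum fun b _ => ?_)
  have h1 : |x a| ≤ 1 := by rw [← hx]; exact PiLp.norm_apply_le x a
  have h2 : |y b| ≤ 1 := by rw [← hy]; exact PiLp.norm_apply_le y b
  rw [show x a * A a b * y b - x a * B a b * y b = x a * ((A a b - B a b) * y b) by ring,
    abs_mul, abs_mul]
  have h3 := mul_le_of_le_one_right (abs_nonneg (A a b - B a b)) h2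
  exact (mul_le_of_le_one_left (by positivity) h1).trans h3

theorem tendsto_bform {ι : Type*} {l : Filter ι} {A : ι → Matrix (Fin (m + 1)) (Fin (m + 1)) ℝ}
    {S : Matrix (Fin (m + 1)) (Fin (m + 1)) ℝ} {x y : ι → Vec m} {u v : Vec m}
    (hA : ∀ a b, Tendsto (fun i => A i a b) l (𝓝 (S a b))) (hx : Tendsto x l (𝓝 u))
    (hy : Tendsto y l (𝓝 v)) : Tendsto (fun i => bform (A i) (x i) (y i)) l (𝓝 (bform S u v)) := by
  simp only [bform_eq_sum]
  have hc : ∀ a : Fin (m + 1), Continuous fun x : Vec m => x a := fun a => by fun_prop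
  exact tendsto_finsetSum _ fun a _ => tendsto_finsetSum _ fun b _ =>
    ((((hc a).tendsto u).comp hx).mul (hA a b)).mul (((hc b).tendsto v).comp hy)

namespace IsOrderedEigensystem

variable {A : Matrix (Fin (m + 1)) (Fin (m + 1)) ℝ} {d : Fin (m + 1) → ℝ}
  {g : OrthonormalBasis (Fin (m + 1)) ℝ (Vec m)}

theorem bform_right (h : IsOrderedEigensystem A d g) (x : Vec m) (a : Fin (m + 1)) :
    bform A x (g a) = d a * ⟪x, g a⟫ := by
  rw [bform, h.2, real_inner_smul_right]

theorem bform_self (h : IsOrderedEigensystem A d g) (a : Fin (m + 1)) :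
    bform A (g a) (g a) = d a := by
  rw [h.bform_right, real_inner_self_eq_norm_sq, g.norm_eq_one]
  simp

theorem bform_eq_sum_eigenvalues (h : IsOrderedEigensystem A d g) (hA : A.IsSymm) (x : Vec m) :
    bform A x x = ∑ a, d a * ⟪g a, x⟫ ^ 2 := by
  rw [bform, ← g.sum_inner_mul_inner]
  refine Finset.sum_congr rfl fun a _ => ?_
  have : ⟪g a, Matrix.toEuclideanLin A x⟫ = d a * ⟪x, g a⟫ :=
    (bform_comm hA (g a) x).trans (h.bform_right x a)
  rw [this, real_inner_comm x]
  ring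

/-- The squared coordinates of `x` in the eigenbasis sum to 1, and all weight off the top direction
costs at least `δ` per unit. -/
theorem bform_le_of_gap (h : IsOrderedEigensystem A d g) (hA : A.IsSymm) {δ : ℝ}
    (hδ : ∀ a : Fin m, d a.castSucc + δ ≤ d (Fin.last m)) {x : Vec m} (hx : ‖x‖ = 1) :
    bform A x x ≤ d (Fin.last m) - δ * (1 - ⟪g (Fin.last m), x⟫ ^ 2) := by
  have h1 : ∑ a, ⟪g a, x⟫ ^ 2 = 1 := by
    have := g.sum_sq_norm_inner_right x
    simpa [hx] using this
  rw [h.bform_eq_sum_eigenvalues hA, Fin.sum_univ_castSucc]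
  rw [Fin.sum_univ_castSucc] at h1
  have h2 : ∑ a : Fin m, d a.castSucc * ⟪g a.castSucc, x⟫ ^ 2 ≤
      (d (Fin.last m) - δ) * ∑ a : Fin m, ⟪g a.castSucc, x⟫ ^ 2 := by
    rw [Finset.mul_sum]
    exact Finset.sum_le_sum fun a _ =>
      mul_le_mul_of_nonneg_right (by linarith [hδ a]) (sq_nonneg _)
  rw [eq_sub_of_add_eq h1] at h2
  linarith

theorem bform_le (h : IsOrderedEigensystem A d g) (hA : A.IsSymm) {x : Vec m} (hx : ‖x‖ = 1) :
    bform A x x ≤ d (Fin.last m) := by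
  have := h.bform_le_of_gap hA (δ := 0) (fun a => by simpa using h.1 (Fin.le_last _)) hx
  simpa using this

end IsOrderedEigensystem

theorem eq_or_eq_neg_of_inner_sq {u v : Vec m} (hu : ‖u‖ = 1) (hv : ‖v‖ = 1)
    (h : ⟪u, v⟫ ^ 2 = 1) : v = u ∨ v = -u := by
  rcases sq_eq_one_iff.1 h with h | h
  · exact Or.inl ((inner_eq_one_iff_of_norm_eq_one hu hv).1 h).symm
  · right
    have : ⟪u, -v⟫ = 1 := by rw [inner_neg_right, h, neg_neg]
    rw [(inner_eq_one_iff_of_norm_eq_one hu (by simpa using hv)).1 this, neg_neg]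

section Limits

variable {S : Matrix (Fin (m + 1)) (Fin (m + 1)) ℝ} {lam : Fin (m + 1) → ℝ}
  {gam : OrthonormalBasis (Fin (m + 1)) ℝ (Vec m)} {ν : Vec m} {δ : ℝ}
  {ι : Type*} {l : Filter ι} {A : ι → Matrix (Fin (m + 1)) (Fin (m + 1)) ℝ}

theorem tendsto_sum_abs_sub (hA : ∀ a b, Tendsto (fun i => A i a b) l (𝓝 (S a b))) :
    Tendsto (fun i => ∑ a, ∑ b, |A i a b - S a b|) l (𝓝 0) := by
  have h : Tendsto (fun i => ∑ a, ∑ b, |A i a b - S a b|) l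
      (𝓝 (∑ a : Fin (m + 1), ∑ b : Fin (m + 1), |S a b - S a b|)) :=
    tendsto_finsetSum _ fun a _ => tendsto_finsetSum _ fun b _ =>
      ((hA a b).sub tendsto_const_nhds).abs
  simpa using h

theorem inner_sq_eq_of_eq_or_eq_neg {u v : Vec m} (hν : v = u ∨ v = -u) (x : Vec m) :
    ⟪u, x⟫ ^ 2 = ⟪v, x⟫ ^ 2 := by
  rcases hν with rfl | rfl <;> simp

/-- The maximizers of the Rayleigh quotients of `A i` converge to the top eigenvector of the
limit of the `A i`, provided the top eigenvalue of the limit is simple. -/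
theorem tendsto_of_rayleigh_max (hS : IsOrderedEigensystem S lam gam) (hsymm : S.IsSymm)
    (hδ0 : 0 < δ) (hδ : ∀ a : Fin m, lam a.castSucc + δ ≤ lam (Fin.last m))
    (hν : ν = gam (Fin.last m) ∨ ν = -gam (Fin.last m))
    (hA : ∀ a b, Tendsto (fun i => A i a b) l (𝓝 (S a b)))
    {h : ι → Vec m} (hh : ∀ i, ‖h i‖ = 1)
    (hmax : ∀ i, bform (A i) ν ν ≤ bform (A i) (h i) (h i)) (hsign : ∀ i, 0 ≤ ⟪ν, h i⟫) :
    Tendsto h l (𝓝 ν) := by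
  have hν1 : ‖ν‖ = 1 := by rcases hν with rfl | rfl <;> simp
  have hνS : bform S ν ν = lam (Fin.last m) := by
    rcases hν with rfl | rfl
    · exact hS.bform_self _
    · rw [← hS.bform_self (Fin.last m)]
      simp [bform]
  have he := tendsto_sum_abs_sub hA
  set e : ι → ℝ := fun i => ∑ a, ∑ b, |A i a b - S a b|
  have hbound : ∀ i, ‖h i - ν‖ ^ 2 ≤ 2 * (δ⁻¹ * (2 * e i)) := by
    intro i
    have h1 := hS.bform_le_of_gap hsymm hδ (hh i)
    rw [inner_sq_eq_of_eq_or_eq_neg hν] at h1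
    have h2 := (abs_le.1 (abs_bform_sub_le (A i) S (hh i) (hh i))).2
    have h3 := (abs_le.1 (abs_bform_sub_le (A i) S hν1 hν1)).1
    -- Passing between `A i` and `S` costs at most `e i` at `h i` and again at `ν`, hence the factor
    -- 2.
    have h4 : δ * (1 - ⟪ν, h i⟫ ^ 2) ≤ 2 * e i := by
      have := hmax i
      simp only [e]
      linarith
    have h5 : 1 - ⟪ν, h i⟫ ^ 2 ≤ δ⁻¹ * (2 * e i) := by
      rw [inv_mul_eq_div, le_div_iff₀ hδ0]
      linarith
    have h6 : ⟪ν, h i⟫ ≤ 1 := by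
      have := real_inner_le_norm ν (h i)
      rwa [hν1, hh i, one_mul] at this
    -- The sign convention enters here: it excludes limits near `-ν` and bounds `‖h i - ν‖ ^ 2 = 2 *
    -- (1 - ⟪ν, h i⟫)` by twice the defect of the square.
    have h7 : ⟪ν, h i⟫ ^ 2 ≤ ⟪ν, h i⟫ := by nlinarith [hsign i]
    rw [norm_sub_sq_real, hh i, hν1, real_inner_comm]
    linarith
  have hlim : Tendsto (fun i => ‖h i - ν‖ ^ 2) l (𝓝 0) := by
    refine squeeze_zero (fun i => sq_nonneg _) hbound ?_
    have := ((he.const_mul 2).const_mul δ⁻¹).const_mul 2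
    simpa using this
  rw [tendsto_iff_norm_sub_tendsto_zero]
  have := hlim.sqrt
  simpa [Real.sqrt_sq (norm_nonneg _)] using this

/-- No convergence of the lower eigenvectors is needed: each is orthogonal to a vector close to `ν`,
so its quotient for `S` stays almost `δ` below the top, while the top eigenvalue of `A i` converges.
-/
theorem eventually_eigenvalue_lt (hS : IsOrderedEigensystem S lam gam) (hsymm : S.IsSymm)
    (hδ0 : 0 < δ) (hδ : ∀ a : Fin m, lam a.castSucc + δ ≤ lam (Fin.last m))
    (hν : ν = gam (Fin.last m) ∨ ν = -gam (Fin.last m))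
    (hA : ∀ a b, Tendsto (fun i => A i a b) l (𝓝 (S a b)))
    {d : ι → Fin (m + 1) → ℝ} {g : ι → OrthonormalBasis (Fin (m + 1)) ℝ (Vec m)}
    (hg : ∀ i, IsOrderedEigensystem (A i) (d i) (g i))
    (hlim : Tendsto (fun i => g i (Fin.last m)) l (𝓝 ν)) :
    ∀ᶠ i in l, ∀ a : Fin m, d i a.castSucc < d i (Fin.last m) := by
  have hν1 : ‖ν‖ = 1 := by rcases hν with rfl | rfl <;> simp
  have hνS : bform S ν ν = lam (Fin.last m) := by
    rcases hν with rfl | rfl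
    · exact hS.bform_self _
    · rw [← hS.bform_self (Fin.last m)]
      simp [bform]
  have htop : Tendsto (fun i => d i (Fin.last m)) l (𝓝 (lam (Fin.last m))) := by
    rw [← hνS]
    refine (tendsto_bform hA hlim hlim).congr fun i => (hg i).bform_self _
  have he := tendsto_sum_abs_sub hA
  have hn : Tendsto (fun i => ‖ν - g i (Fin.last m)‖ ^ 2) l (𝓝 0) := by
    have := ((tendsto_const_nhds (x := ν)).sub hlim).norm.pow 2
    simpa using this
  have hpos : Tendsto (fun i => d i (Fin.last m) - (lam (Fin.last m) -
      δ * (1 - ‖ν - g i (Fin.last m)‖ ^ 2) + ∑ a, ∑ b, |A i a b - S a b|)) l (𝓝 δ) := by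
    have := htop.sub (((tendsto_const_nhds (x := lam (Fin.last m))).sub
      (((tendsto_const_nhds (x := (1 : ℝ))).sub hn).const_mul δ)).add he)
    simpa using this
  filter_upwards [hpos.eventually_const_lt hδ0] with i hi a
  have hga : ‖g i a.castSucc‖ = 1 := (g i).norm_eq_one _
  have h1 := hS.bform_le_of_gap hsymm hδ hga
  rw [inner_sq_eq_of_eq_or_eq_neg hν] at h1
  have h2 := (abs_le.1 (abs_bform_sub_le (A i) S hga hga)).2
  rw [(hg i).bform_self] at h2
  have h3 : ⟪ν, g i a.castSucc⟫ ^ 2 ≤ ‖ν - g i (Fin.last m)‖ ^ 2 := by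
    have h0 : ⟪g i (Fin.last m), g i a.castSucc⟫ = 0 :=
      (g i).inner_eq_zero (Fin.castSucc_lt_last a).ne'
    have : ⟪ν, g i a.castSucc⟫ = ⟪ν - g i (Fin.last m), g i a.castSucc⟫ := by
      rw [inner_sub_left, h0, sub_zero]
    rw [this, sq_le_sq, abs_norm]
    have := abs_real_inner_le_norm (ν - g i (Fin.last m)) (g i a.castSucc)
    rwa [hga, mul_one] at this
  have h4 := mul_le_mul_of_nonneg_left h3 hδ0.le
  linarith

theorem exists_gap (hlt : ∀ a : Fin m, lam a.castSucc < lam (Fin.last m)) :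
    ∃ δ > 0, ∀ a : Fin m, lam a.castSucc + δ ≤ lam (Fin.last m) := by
  rcases isEmpty_or_nonempty (Fin m) with h | h
  · exact ⟨1, one_pos, fun a => isEmptyElim a⟩
  · obtain ⟨a, ha⟩ := Finite.exists_max fun a : Fin m => lam a.castSucc
    exact ⟨lam (Fin.last m) - lam a.castSucc, sub_pos.2 (hlt a), fun b => by linarith [ha b]⟩

end Limits

end EigenvectorPerturbation

/-! ### The statistic as an exact quadratic form in the mean score -/

section ExactIdentity

variable {q m : ℕ}

/-- Invariance under congruence; invertibility of `Q` is forced by that of `K`. -/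
theorem dotProduct_inv_mulVec_congr {ι : Type*} [Fintype ι] [DecidableEq ι] {Q G K : Matrix ι ι ℝ}
    (hK : K = Q * G * Qᵀ) (hdet : K.det ≠ 0) (v : ι → ℝ) :
    (Q *ᵥ v) ⬝ᵥ (K⁻¹ *ᵥ (Q *ᵥ v)) = v ⬝ᵥ (G⁻¹ *ᵥ v) := by
  have hQ : IsUnit Q.det := by
    rw [isUnit_iff_ne_zero]
    intro h
    rw [hK, Matrix.det_mul, Matrix.det_mul, h] at hdet
    simp at hdet
  have hQt : IsUnit Qᵀ.det := by rwa [Matrix.det_transpose]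
  rw [Matrix.mulVec_mulVec, ← Matrix.vecMul_transpose, ← Matrix.dotProduct_mulVec,
    Matrix.mulVec_mulVec, hK, Matrix.mul_inv_rev, Matrix.mul_inv_rev]
  congr 2
  rw [Matrix.mul_assoc, Matrix.mul_assoc, Matrix.nonsing_inv_mul _ hQ, Matrix.mul_one,
    ← Matrix.mul_assoc, Matrix.mul_nonsing_inv _ hQt, Matrix.one_mul]

/-- The coordinates `(γ_s(a)ᵀ x_s) (ν_sᵀ x_s)` of the score vector of an observation. -/
noncomputable def score (gam : Fin q → OrthonormalBasis (Fin (m + 1)) ℝ (Vec m))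
    (ν : Fin q → Vec m) (x : Fin q → Vec m) (i : Fin q × Fin m) : ℝ :=
  ⟪gam i.1 i.2.castSucc, x i.1⟫ * ⟪ν i.1, x i.1⟫

/-- The score vector at `h`, with the basis vectors projected orthogonally to `h`. -/
noncomputable def projScore (gam : Fin q → OrthonormalBasis (Fin (m + 1)) ℝ (Vec m))
    (h : Fin q → Vec m) (x : Fin q → Vec m) (i : Fin q × Fin m) : ℝ :=
  ⟪gam i.1 i.2.castSucc - ⟪gam i.1 i.2.castSucc, h i.1⟫ • h i.1, x i.1⟫ * ⟪h i.1, x i.1⟫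

/-- The empirical second moment matrix of the projected scores. -/
noncomputable def scoreCov (n : ℕ) (gam : Fin q → OrthonormalBasis (Fin (m + 1)) ℝ (Vec m))
    (x : ℕ → Fin q → Vec m) (h : Fin q → Vec m) : Matrix (Fin q × Fin m) (Fin q × Fin m) ℝ :=
  (n : ℝ)⁻¹ • ∑ r ∈ Finset.range n,
    Matrix.vecMulVec (projScore gam h (x r)) (projScore gam h (x r))

/-- The block diagonal change of coordinates from the sample eigenbases to the bases `gam`,
weighted by the eigenvalue gaps. -/
noncomputable def changeFrame (gam g : Fin q → OrthonormalBasis (Fin (m + 1)) ℝ (Vec m))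
    (d : Fin q → Fin (m + 1) → ℝ) : Matrix (Fin q × Fin m) (Fin q × Fin m) ℝ :=
  Matrix.of fun i k => if i.1 = k.1 then
    ⟪gam i.1 i.2.castSucc, g i.1 k.2.castSucc⟫ * (d i.1 (Fin.last m) - d i.1 k.2.castSucc) else 0

theorem changeFrame_mulVec (gam g : Fin q → OrthonormalBasis (Fin (m + 1)) ℝ (Vec m))
    (d : Fin q → Fin (m + 1) → ℝ) (v : Fin q × Fin m → ℝ) (i : Fin q × Fin m) :
    (changeFrame gam g d *ᵥ v) i = ∑ a : Fin m, ⟪gam i.1 i.2.castSucc, g i.1 a.castSucc⟫ *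
      (d i.1 (Fin.last m) - d i.1 a.castSucc) * v (i.1, a) := by
  simp only [changeFrame, Matrix.mulVec, dotProduct, Matrix.of_apply, Fintype.sum_prod_type,
    ite_mul, zero_mul]
  rw [Finset.sum_eq_single i.1]
  · simp
  · intro s _ hs
    simp [Ne.symm hs]
  · simp

theorem sampleMoment_isSymm (n : ℕ) (x : ℕ → Fin q → Vec m) (s : Fin q) :
    (sampleMoment n x s).IsSymm := by
  ext a b
  simp [sampleMoment, mul_comm]

theorem bform_sampleMoment (n : ℕ) (x : ℕ → Fin q → Vec m) (s : Fin q) (u v : Vec m) :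
    bform (sampleMoment n x s) u v =
      (n : ℝ)⁻¹ * ∑ r ∈ Finset.range n, ⟪u, x r s⟫ * ⟪v, x r s⟫ := by
  have h : ∀ r, ⟪u, x r s⟫ * ⟪v, x r s⟫ = ∑ a, ∑ b, u a * (x r s a * x r s b) * v b := by
    intro r
    simp only [PiLp.inner_apply, RCLike.inner_apply, conj_trivial, Finset.sum_mul_sum]
    exact Finset.sum_congr rfl fun a _ => Finset.sum_congr rfl fun b _ => by ring
  simp_rw [h]
  rw [bform_eq_sum, Finset.sum_comm (s := Finset.range n), Finset.mul_sum]
  refine Finset.sum_congr rfl fun a _ => ?_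
  rw [Finset.sum_comm, Finset.mul_sum]
  refine Finset.sum_congr rfl fun b _ => ?_
  rw [← Finset.sum_mul, ← Finset.mul_sum, sampleMoment, Matrix.of_apply]
  ring

theorem IsOrderedEigensystem.sum_eigenvalues_mul_inner {A : Matrix (Fin (m + 1)) (Fin (m + 1)) ℝ}
    {d : Fin (m + 1) → ℝ} {g : OrthonormalBasis (Fin (m + 1)) ℝ (Vec m)}
    (h : IsOrderedEigensystem A d g) (hA : A.IsSymm) (x y : Vec m) :
    bform A x y = ∑ a, d a * (⟪x, g a⟫ * ⟪y, g a⟫) := by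
  rw [bform, ← g.sum_inner_mul_inner]
  refine Finset.sum_congr rfl fun a _ => ?_
  have : ⟪g a, Matrix.toEuclideanLin A y⟫ = d a * ⟪y, g a⟫ :=
    (bform_comm hA (g a) y).trans (h.bform_right y a)
  rw [this]
  ring

variable {n : ℕ} {x : ℕ → Fin q → Vec m} {d : Fin q → Fin (m + 1) → ℝ}
  {g gam : Fin q → OrthonormalBasis (Fin (m + 1)) ℝ (Vec m)} {ν : Fin q → Vec m}

/-- Both sides come from the spectral expansion of the form of `J_s` at the pair `gam`, `ν`. By
Parseval and orthogonality, the top eigenvalue times a zero sum may be subtracted; this removes the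
top term and turns the eigenvalues into gaps. -/
theorem changeFrame_mulVec_deviation
    (hg : ∀ s, IsOrderedEigensystem (sampleMoment n x s) (d s) (g s))
    (hν : ∀ s (a : Fin m), ⟪gam s a.castSucc, ν s⟫ = 0) :
    changeFrame gam g d *ᵥ deviation g ν =
      -((n : ℝ)⁻¹ • ∑ r ∈ Finset.range n, score gam ν (x r)) := by
  funext i
  have h1 := (hg i.1).sum_eigenvalues_mul_inner (sampleMoment_isSymm n x i.1)
    (gam i.1 i.2.castSucc) (ν i.1)
  have h2 : ∑ a, ⟪gam i.1 i.2.castSucc, g i.1 a⟫ * ⟪g i.1 a, ν i.1⟫ = 0 := by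
    rw [(g i.1).sum_inner_mul_inner, hν]
  rw [bform_sampleMoment] at h1
  rw [changeFrame_mulVec]
  simp only [Pi.neg_apply, Pi.smul_apply, Finset.sum_apply, score, smul_eq_mul, h1, deviation]
  have h3 : ∑ a, ⟪gam i.1 i.2.castSucc, g i.1 a⟫ * (d i.1 (Fin.last m) - d i.1 a) *
      ⟪ν i.1, g i.1 a⟫ = -∑ a, d i.1 a * (⟪gam i.1 i.2.castSucc, g i.1 a⟫ * ⟪ν i.1, g i.1 a⟫) := by
    rw [← zero_sub, ← mul_zero (d i.1 (Fin.last m)), ← h2, Finset.mul_sum,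
      ← Finset.sum_sub_distrib]
    exact Finset.sum_congr rfl fun a _ => by rw [real_inner_comm (ν i.1)]; ring
  rw [← h3, Fin.sum_univ_castSucc]
  simp

/-- The gaps in the frame change cancel the inverse gaps in `sampleCov`, which is where strictness
is needed. Summing over the lower eigenvectors leaves the projection orthogonal to the top one, so
the others disappear. -/
theorem scoreCov_eq (hgap : ∀ s (a : Fin m), d s a.castSucc < d s (Fin.last m)) :
    scoreCov n gam x (fun s => g s (Fin.last m)) =
      changeFrame gam g d * sampleCov n x d g * (changeFrame gam g d)ᵀ := by
  set ζ : ℕ → Fin q × Fin m → ℝ := fun r i =>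
    (d i.1 (Fin.last m) - d i.1 i.2.castSucc)⁻¹ *
      (⟪g i.1 i.2.castSucc, x r i.1⟫ * ⟪g i.1 (Fin.last m), x r i.1⟫) with hζ
  have hG : sampleCov n x d g =
      (n : ℝ)⁻¹ • ∑ r ∈ Finset.range n, Matrix.vecMulVec (ζ r) (ζ r) := by
    ext i k
    simp only [sampleCov, Matrix.of_apply, Matrix.smul_apply, Matrix.sum_apply,
      Matrix.vecMulVec_apply, smul_eq_mul, hζ]
    rw [mul_assoc, mul_assoc, Finset.mul_sum, Finset.mul_sum]
    congr 1
    exact Finset.sum_congr rfl fun r _ => by ring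
  have hQ : ∀ r, changeFrame gam g d *ᵥ ζ r =
      projScore gam (fun s => g s (Fin.last m)) (x r) := by
    intro r
    funext i
    rw [changeFrame_mulVec]
    have h1 := (g i.1).sum_inner_mul_inner (gam i.1 i.2.castSucc) (x r i.1)
    rw [Fin.sum_univ_castSucc] at h1
    rw [projScore, inner_sub_left, real_inner_smul_left, ← h1, add_sub_cancel_right,
      Finset.sum_mul]
    refine Finset.sum_congr rfl fun a _ => ?_
    have : d i.1 (Fin.last m) - d i.1 a.castSucc ≠ 0 := (sub_pos.2 (hgap _ _)).ne'
    simp only [hζ]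
    field_simp
  rw [hG, scoreCov, Matrix.mul_smul, Matrix.smul_mul, Matrix.mul_sum, Matrix.sum_mul]
  congr 1
  refine Finset.sum_congr rfl fun r _ => ?_
  rw [← hQ, Matrix.mul_vecMulVec, Matrix.vecMulVec_mul, Matrix.vecMul_transpose]

/-- The statistic is an exact quadratic form in the mean score vector. -/
theorem hotelling_eq (hg : ∀ s, IsOrderedEigensystem (sampleMoment n x s) (d s) (g s))
    (hν : ∀ s (a : Fin m), ⟪gam s a.castSucc, ν s⟫ = 0)
    (hgap : ∀ s (a : Fin m), d s a.castSucc < d s (Fin.last m))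
    (hdet : (scoreCov n gam x fun s => g s (Fin.last m)).det ≠ 0) :
    hotelling n x d g ν = ((√n)⁻¹ • ∑ r ∈ Finset.range n, score gam ν (x r)) ⬝ᵥ
      ((scoreCov n gam x fun s => g s (Fin.last m))⁻¹ *ᵥ
        ((√n)⁻¹ • ∑ r ∈ Finset.range n, score gam ν (x r))) := by
  rw [hotelling, ← dotProduct_inv_mulVec_congr (scoreCov_eq hgap) hdet,
    changeFrame_mulVec_deviation hg hν]
  simp only [Matrix.mulVec_neg, Matrix.mulVec_smul, neg_dotProduct_neg, smul_dotProduct,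
    dotProduct_smul, smul_eq_mul, ← mul_assoc]
  congr 1
  -- Normalizations agree since `n * n⁻¹ * n⁻¹ = (√n)⁻¹ * (√n)⁻¹`.
  rcases n.eq_zero_or_pos with rfl | hn
  · simp
  · have : (n : ℝ) ≠ 0 := by positivity
    rw [← mul_inv (√(n : ℝ)), Real.mul_self_sqrt (Nat.cast_nonneg n)]
    field_simp

end ExactIdentity

/-! ### Convergence of the empirical second moments of the scores -/

section ScoreLimit

variable {q m : ℕ}

/-- Separates parameters from data. The data enter only through products of two coordinates, which
do not depend on the signs of the representatives. -/
theorem inner_mul_inner_mul_eq_sum (u v w z x y : Vec m) :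
    (⟪u, x⟫ * ⟪v, x⟫) * (⟪w, y⟫ * ⟪z, y⟫) =
      ∑ a, ∑ b, ∑ c, ∑ e, (u a * v b * w c * z e) * ((x a * x b) * (y c * y e)) := by
  simp only [PiLp.inner_apply, RCLike.inner_apply, conj_trivial, Finset.sum_mul_sum]
  refine Finset.sum_congr rfl fun a _ => ?_
  rw [Finset.sum_comm]
  refine Finset.sum_congr rfl fun b _ => ?_
  exact Finset.sum_congr rfl fun c _ => Finset.sum_congr rfl fun e _ => by ring

/-- The plugged-in vectors depend on `n`, so the summands are not a fixed function of the
observations; but each entry is a finite combination of fourth order averages with coefficients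
continuous in those vectors. -/
theorem tendsto_scoreCov {gam : Fin q → OrthonormalBasis (Fin (m + 1)) ℝ (Vec m)}
    {ν : Fin q → Vec m} (hν : ∀ s (a : Fin m), ⟪gam s a.castSucc, ν s⟫ = 0)
    {x : ℕ → Fin q → Vec m} {h : ℕ → Fin q → Vec m}
    (hh : ∀ s, Tendsto (fun n => h n s) atTop (𝓝 (ν s)))
    {μ : Fin q → Fin q → Fin (m + 1) → Fin (m + 1) → Fin (m + 1) → Fin (m + 1) → ℝ}
    (hμ : ∀ s t a b c e, Tendsto (fun n : ℕ => (n : ℝ)⁻¹ * ∑ r ∈ Finset.range n,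
      (x r s a * x r s b) * (x r t c * x r t e)) atTop (𝓝 (μ s t a b c e))) :
    Tendsto (fun n => scoreCov n gam x (h n)) atTop (𝓝 (Matrix.of fun i k =>
      ∑ a, ∑ b, ∑ c, ∑ e, (gam i.1 i.2.castSucc a * ν i.1 b * gam k.1 k.2.castSucc c * ν k.1 e) *
        μ i.1 k.1 a b c e)) := by
  refine tendsto_pi_nhds.2 fun i => tendsto_pi_nhds.2 fun k => ?_
  have hp : ∀ i : Fin q × Fin m, Tendsto (fun n =>
      gam i.1 i.2.castSucc - ⟪gam i.1 i.2.castSucc, h n i.1⟫ • h n i.1) atTop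
      (𝓝 (gam i.1 i.2.castSucc)) := by
    intro i
    have := (tendsto_const_nhds (x := gam i.1 i.2.castSucc)).sub
      (((tendsto_const_nhds (x := gam i.1 i.2.castSucc)).inner (𝕜 := ℝ) (hh i.1)).smul (hh i.1))
    simpa [hν] using this
  have hc : ∀ a : Fin (m + 1), Continuous fun x : Vec m => x a := fun a => by fun_prop
  have heq : ∀ n, scoreCov n gam x (h n) i k = ∑ a, ∑ b, ∑ c, ∑ e,
      ((gam i.1 i.2.castSucc - ⟪gam i.1 i.2.castSucc, h n i.1⟫ • h n i.1) a * h n i.1 b *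
        (gam k.1 k.2.castSucc - ⟪gam k.1 k.2.castSucc, h n k.1⟫ • h n k.1) c * h n k.1 e) *
      ((n : ℝ)⁻¹ * ∑ r ∈ Finset.range n,
        (x r i.1 a * x r i.1 b) * (x r k.1 c * x r k.1 e)) := by
    intro n
    simp only [scoreCov, Matrix.smul_apply, Matrix.sum_apply, Matrix.vecMulVec_apply, projScore,
      inner_mul_inner_mul_eq_sum, smul_eq_mul]
    rw [Finset.sum_comm, Finset.mul_sum]
    refine Finset.sum_congr rfl fun a _ => ?_
    rw [Finset.sum_comm, Finset.mul_sum]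
    refine Finset.sum_congr rfl fun b _ => ?_
    rw [Finset.sum_comm, Finset.mul_sum]
    refine Finset.sum_congr rfl fun c _ => ?_
    rw [Finset.sum_comm, Finset.mul_sum]
    refine Finset.sum_congr rfl fun e _ => ?_
    rw [← Finset.mul_sum]
    ring
  refine Tendsto.congr (fun n => (heq n).symm) ?_
  refine tendsto_finsetSum _ fun a _ => tendsto_finsetSum _ fun b _ =>
    tendsto_finsetSum _ fun c _ => tendsto_finsetSum _ fun e _ => ?_
  exact (((((hc a).tendsto _).comp (hp i)).mul (((hc b).tendsto _).comp (hh i.1))).mul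
    (((hc c).tendsto _).comp (hp k))).mul (((hc e).tendsto _).comp (hh k.1))|>.mul
      (hμ i.1 k.1 a b c e)

end ScoreLimit

/-! ### Nearest points as Rayleigh maximizers -/

section Nearest

variable {q m : ℕ}

theorem exists_isUnitRep (p : RP m) : ∃ x, IsUnitRep x p := by
  have h0 : ‖p.rep‖ ≠ 0 := norm_ne_zero_iff.2 p.rep_nonzero
  refine ⟨‖p.rep‖⁻¹ • p.rep, ?_, smul_ne_zero (inv_ne_zero h0) p.rep_nonzero, ?_⟩
  · rw [norm_smul, norm_inv, norm_norm, inv_mul_cancel₀ h0]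
  · conv_rhs => rw [← p.mk_rep]
    exact (Projectivization.mk_eq_mk_iff' ℝ _ _ _ _).2 ⟨‖p.rep‖⁻¹, rfl⟩

theorem isUnitRep_mk {x : Vec m} (hx : ‖x‖ = 1) :
    IsUnitRep x (Projectivization.mk ℝ x (norm_ne_zero_iff.1 (by simp [hx]))) :=
  ⟨hx, _, rfl⟩

theorem IsUnitRep.neg {x : Vec m} {p : RP m} (h : IsUnitRep x p) : IsUnitRep (-x) p := by
  obtain ⟨hx, h0, rfl⟩ := h
  exact ⟨by simpa using hx, neg_ne_zero.2 h0,
    (Projectivization.mk_eq_mk_iff' ℝ _ _ _ _).2 ⟨-1, by simp⟩⟩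

/-- The matrices `x xᵀ` and `y yᵀ` coincide, so `⟪x, y⟫ ^ 2`, their Frobenius product, equals 1. -/
theorem IsUnitRep.eq_or_eq_neg {x y : Vec m} {p : RP m} (hx : IsUnitRep x p)
    (hy : IsUnitRep y p) : y = x ∨ y = -x := by
  refine eq_or_eq_neg_of_inner_sq hx.1 hy.1 ?_
  have h1 : ⟪x, x⟫ = 1 := by rw [real_inner_self_eq_norm_sq, hx.1, one_pow]
  rw [← one_mul (1 : ℝ), ← h1, sq]
  simp only [PiLp.inner_apply, RCLike.inner_apply, conj_trivial, Finset.sum_mul_sum]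
  refine Finset.sum_congr rfl fun a _ => Finset.sum_congr rfl fun b _ => ?_
  have := (jEntry_eq hx a b).symm.trans (jEntry_eq hy a b)
  linear_combination -(x a * x b) * this

/-- The `s`-th component of a tuple of symmetric matrices. -/
def block (v : SymTuple q m) (s : Fin q) : Matrix (Fin (m + 1)) (Fin (m + 1)) ℝ :=
  Matrix.of fun a b => v.1 (s, a, b)

theorem block_isSymm (v : SymTuple q m) (s : Fin q) : (block v s).IsSymm := by
  ext a b
  exact v.2 s b a

theorem block_add_smul (v V : SymTuple q m) (t : ℝ) (s : Fin q) :
    block (v + t • V) s = block v s + t • block V s := by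
  ext a b
  simp [block]

theorem inner_symTuple (u v : SymTuple q m) :
    ⟪u, v⟫ = ∑ s, ∑ a, ∑ b, u.1 (s, a, b) * v.1 (s, a, b) := by
  rw [Submodule.coe_inner, PiLp.inner_apply, Fintype.sum_prod_type]
  refine Finset.sum_congr rfl fun s _ => ?_
  rw [Fintype.sum_prod_type]
  exact Finset.sum_congr rfl fun a _ => Finset.sum_congr rfl fun b _ => mul_comm _ _

theorem jk_apply {p : Fin q → RP m} {h : Fin q → Vec m} (hp : ∀ s, IsUnitRep (h s) (p s))
    (s : Fin q) (a b : Fin (m + 1)) : (jk p).1 (s, a, b) = h s a * h s b :=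
  jEntry_eq (hp s) a b

theorem inner_jk {p : Fin q → RP m} {h : Fin q → Vec m} (hp : ∀ s, IsUnitRep (h s) (p s))
    (v : SymTuple q m) : ⟪jk p, v⟫ = ∑ s, bform (block v s) (h s) (h s) := by
  rw [inner_symTuple]
  refine Finset.sum_congr rfl fun s _ => ?_
  rw [bform_eq_sum]
  refine Finset.sum_congr rfl fun a _ => Finset.sum_congr rfl fun b _ => ?_
  rw [jk_apply hp, block, Matrix.of_apply]
  ring

theorem block_jk {p : Fin q → RP m} {h : Fin q → Vec m} (hp : ∀ s, IsUnitRep (h s) (p s))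
    (s : Fin q) (x y : Vec m) : bform (block (jk p) s) x y = ⟪x, h s⟫ * ⟪y, h s⟫ := by
  simp only [bform_eq_sum, block, Matrix.of_apply, jk_apply hp, PiLp.inner_apply,
    RCLike.inner_apply, conj_trivial, Finset.sum_mul_sum]
  exact Finset.sum_congr rfl fun a _ => Finset.sum_congr rfl fun b _ => by ring

theorem norm_sq_jk (p : Fin q → RP m) : ‖jk p‖ ^ 2 = q := by
  choose h hp using fun s => exists_isUnitRep (p s)
  rw [← real_inner_self_eq_norm_sq, inner_jk hp]
  simp [block_jk hp, (hp _).1]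

/-- The image of `jk` lies on the sphere of radius `√q`, so minimal distance is maximal inner
product. -/
theorem isNearest_jk_iff {p : Fin q → RP m} {v : SymTuple q m} :
    IsNearest jk v p ↔ ∀ p' : Fin q → RP m, ⟪jk p', v⟫ ≤ ⟪jk p, v⟫ := by
  refine forall_congr' fun p' => ?_
  rw [dist_eq_norm, dist_eq_norm, ← sq_le_sq₀ (norm_nonneg _) (norm_nonneg _), norm_sub_sq_real,
    norm_sub_sq_real, norm_sq_jk, norm_sq_jk]
  constructor <;> intro h <;> linarith

theorem isNearest_of_rayleigh_max {p : Fin q → RP m} {h : Fin q → Vec m}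
    (hp : ∀ s, IsUnitRep (h s) (p s)) {v : SymTuple q m}
    (hmax : ∀ s x, ‖x‖ = 1 → bform (block v s) x x ≤ bform (block v s) (h s) (h s)) :
    IsNearest jk v p := by
  rw [isNearest_jk_iff]
  intro p'
  choose h' hp' using fun s => exists_isUnitRep (p' s)
  rw [inner_jk hp, inner_jk hp']
  exact Finset.sum_le_sum fun s _ => hmax s _ (hp' s).1

/-- The inner product is a sum of one Rayleigh quotient per component, and the components vary
independently. -/
theorem IsNearest.rayleigh_max {p : Fin q → RP m} {h : Fin q → Vec m} {v : SymTuple q m}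
    (hn : IsNearest jk v p) (hp : ∀ s, IsUnitRep (h s) (p s)) (s : Fin q) {x : Vec m}
    (hx : ‖x‖ = 1) : bform (block v s) x x ≤ bform (block v s) (h s) (h s) := by
  classical
  have hp' : ∀ t, IsUnitRep (Function.update h s x t)
      (Function.update p s (Projectivization.mk ℝ x (norm_ne_zero_iff.1 (by simp [hx]))) t) := by
    intro t
    rcases eq_or_ne t s with rfl | ht
    · simpa using isUnitRep_mk hx
    · simpa [ht] using hp t
  have h1 := isNearest_jk_iff.1 hn
    (Function.update p s (Projectivization.mk ℝ x (norm_ne_zero_iff.1 (by simp [hx]))))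
  rw [inner_jk hp, inner_jk hp', ← Finset.add_sum_erase _ _ (Finset.mem_univ s),
    ← Finset.add_sum_erase _ _ (Finset.mem_univ s)] at h1
  have h2 : ∀ t ∈ Finset.univ.erase s, bform (block v t) (Function.update h s x t)
      (Function.update h s x t) = bform (block v t) (h t) (h t) := by
    intro t ht
    simp [Finset.ne_of_mem_erase ht]
  rw [Finset.sum_congr rfl h2, Function.update_self] at h1
  exact le_of_add_le_add_right h1

theorem exists_rayleigh_max (A : Matrix (Fin (m + 1)) (Fin (m + 1)) ℝ) :
    ∃ h : Vec m, ‖h‖ = 1 ∧ ∀ x, ‖x‖ = 1 → bform A x x ≤ bform A h h := by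
  have hne : (Metric.sphere (0 : Vec m) 1).Nonempty := NormedSpace.sphere_nonempty.2 zero_le_one
  have hcont : Continuous fun x : Vec m => bform A x x := by
    simp only [bform_eq_sum]
    fun_prop
  obtain ⟨h, hh, hmax⟩ := (isCompact_sphere (0 : Vec m) 1).exists_isMaxOn hne hcont.continuousOn
  exact ⟨h, by simpa using hh, fun x hx => hmax (by simpa using hx)⟩

/-- Compactness of the spheres makes the choice genuine at every `v`, focal or not; the derivative
computation needs this along a whole line. -/
theorem isNearest_nearest (v : SymTuple q m) : IsNearest jk v (nearest jk v) := by
  choose h hh hmax using fun s => exists_rayleigh_max (block v s)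
  exact Classical.epsilon_spec
    ⟨_, isNearest_of_rayleigh_max (fun s => isUnitRep_mk (hh s)) hmax⟩

/-- Lagrange multipliers: a maximizer on the sphere is an eigenvector for its own Rayleigh quotient.
-/
theorem toEuclideanLin_eq_smul_of_rayleigh_max {A : Matrix (Fin (m + 1)) (Fin (m + 1)) ℝ}
    (hA : A.IsSymm) {h : Vec m} (hh : ‖h‖ = 1)
    (hmax : ∀ x, ‖x‖ = 1 → bform A x x ≤ bform A h h) :
    Matrix.toEuclideanLin A h = bform A h h • h := by
  set T : Vec m →L[ℝ] Vec m := LinearMap.toContinuousLinearMap (Matrix.toEuclideanLin A)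
  have hT : ∀ x, T x = Matrix.toEuclideanLin A x := fun x => rfl
  have hself : IsSelfAdjoint T := by
    rw [ContinuousLinearMap.isSelfAdjoint_iff_isSymmetric]
    intro x y
    exact (real_inner_comm y (T x)).trans (bform_comm hA y x)
  have hre : ∀ x, T.reApplyInnerSelf x = bform A x x := fun x => by
    rw [ContinuousLinearMap.reApplyInnerSelf_apply, hT, RCLike.re_to_real, bform,
      real_inner_comm]
  have hext : IsLocalExtrOn T.reApplyInnerSelf (Metric.sphere 0 ‖h‖) h := by
    refine Or.inr (IsMaxOn.localize fun x hx => ?_)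
    simp only [Set.mem_ofPred_eq, hre]
    exact hmax x (by simpa [hh] using hx)
  have := hself.eq_smul_self_of_isLocalExtrOn_real hext
  rw [hT, ContinuousLinearMap.rayleighQuotient, hre, hh] at this
  simpa using this

end Nearest

/-! ### Simple top eigenvalues and the derivative of the projection -/

section Nonfocal

variable {q m : ℕ} {v : SymTuple q m} {lam : Fin q → Fin (m + 1) → ℝ}
  {gam : Fin q → OrthonormalBasis (Fin (m + 1)) ℝ (Vec m)} {ν : Fin q → Vec m}

/-- Taking any top eigenvector in position `s` still gives a nearest point, which uniqueness
identifies with the given one. -/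
theorem eq_or_eq_neg_of_isNonfocal (hv : IsNonfocal jk v)
    (hgam : ∀ s, IsOrderedEigensystem (block v s) (lam s) (gam s))
    (hν : ∀ s, IsUnitRep (ν s) (nearest jk v s)) (s : Fin q) (a : Fin (m + 1))
    (ha : lam s a = lam s (Fin.last m)) : ν s = gam s a ∨ ν s = -gam s a := by
  classical
  set h : Fin q → Vec m := fun t => if t = s then gam t a else gam t (Fin.last m) with hdef
  have hh : ∀ t, ‖h t‖ = 1 := by
    intro t
    simp only [hdef]
    split_ifs <;> exact (gam t).norm_eq_one _
  have hval : ∀ t, bform (block v t) (h t) (h t) = lam t (Fin.last m) := by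
    intro t
    simp only [hdef]
    split_ifs with hts
    · subst hts
      rw [(hgam t).bform_self, ha]
    · exact (hgam t).bform_self _
  have hnear : IsNearest jk v fun t => Projectivization.mk ℝ (h t)
      (norm_ne_zero_iff.1 (by simp [hh])) :=
    isNearest_of_rayleigh_max (fun t => isUnitRep_mk (hh t)) fun t x hx => by
      rw [hval]
      exact (hgam t).bform_le (block_isSymm v t) hx
  have heq := congrFun (hv.unique (isNearest_nearest v) hnear) s
  have h1 := isUnitRep_mk (hh s)
  rw [← heq] at h1
  simpa [hdef] using h1.eq_or_eq_neg (hν s)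

/-- In case of equality, two orthogonal unit eigenvectors would both be `±ν s`. -/
theorem eigenvalue_lt_of_isNonfocal (hv : IsNonfocal jk v)
    (hgam : ∀ s, IsOrderedEigensystem (block v s) (lam s) (gam s)) (s : Fin q) (a : Fin m) :
    lam s a.castSucc < lam s (Fin.last m) := by
  refine lt_of_le_of_ne ((hgam s).1 (Fin.le_last _)) fun ha => ?_
  choose ν hν using fun s => exists_isUnitRep (nearest jk v s)
  have h0 : ⟪gam s a.castSucc, gam s (Fin.last m)⟫ = 0 :=
    (gam s).inner_eq_zero (Fin.castSucc_lt_last a).ne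
  have h2 : ⟪gam s a.castSucc, ν s⟫ = 0 := by
    rcases eq_or_eq_neg_of_isNonfocal hv hgam hν s _ rfl with h | h <;> simp [h, h0]
  rcases eq_or_eq_neg_of_isNonfocal hv hgam hν s _ ha with h | h <;> simp [h] at h2

theorem inner_castSucc_eq_zero (hν : ∀ s, ν s = gam s (Fin.last m) ∨ ν s = -gam s (Fin.last m))
    (s : Fin q) (a : Fin m) : ⟪gam s a.castSucc, ν s⟫ = 0 := by
  have h0 : ⟪gam s a.castSucc, gam s (Fin.last m)⟫ = 0 :=
    (gam s).inner_eq_zero (Fin.castSucc_lt_last a).ne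
  rcases hν s with h | h <;> simp [h, h0]

theorem inner_tangentFrame (ν : Fin q → Vec m) (w : Fin q → Fin m → Vec m) (k : Fin q × Fin m)
    (V : SymTuple q m) :
    ⟪tangentFrame ν w k, V⟫ = 2 * bform (block V k.1) (w k.1 k.2) (ν k.1) := by
  have h1 : ⟪tangentFrame ν w k, V⟫ =
      bform (block V k.1) (w k.1 k.2) (ν k.1) + bform (block V k.1) (ν k.1) (w k.1 k.2) := by
    rw [inner_symTuple, Finset.sum_eq_single k.1]
    · simp only [tangentFrame, bform_eq_sum, ← Finset.sum_add_distrib, block, Matrix.of_apply,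
        if_true]
      exact Finset.sum_congr rfl fun a _ => Finset.sum_congr rfl fun b _ => by ring
    · intro s _ hs
      simp [tangentFrame, hs]
    · simp
  rw [h1, bform_comm (block_isSymm V k.1) (ν k.1)]
  ring

theorem inner_tangentFrame_self {w : Fin q → Fin m → Vec m} {k : Fin q × Fin m}
    (hν : ‖ν k.1‖ = 1) (hw : ‖w k.1 k.2‖ = 1) (horth : ⟪w k.1 k.2, ν k.1⟫ = 0) :
    ⟪tangentFrame ν w k, tangentFrame ν w k⟫ = 2 := by
  have h1 : bform (block (tangentFrame ν w k) k.1) (w k.1 k.2) (ν k.1) =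
      ⟪w k.1 k.2, w k.1 k.2⟫ * ⟪ν k.1, ν k.1⟫ + ⟪w k.1 k.2, ν k.1⟫ * ⟪w k.1 k.2, ν k.1⟫ := by
    simp only [bform_eq_sum, block, Matrix.of_apply, tangentFrame, if_true, PiLp.inner_apply,
      RCLike.inner_apply, conj_trivial, Finset.sum_mul_sum, ← Finset.sum_add_distrib]
    exact Finset.sum_congr rfl fun a _ => Finset.sum_congr rfl fun b _ => by ring
  rw [inner_tangentFrame, h1, horth, real_inner_self_eq_norm_sq, real_inner_self_eq_norm_sq,
    hν, hw]
  norm_num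

/-- The derivative of the nearest-point projection in the coordinates of the tangent frame. -/
theorem inner_tangentFrame_fderiv (hv : IsNonfocal jk v)
    (hgam : ∀ s, IsOrderedEigensystem (block v s) (lam s) (gam s))
    (hν : ∀ s, IsUnitRep (ν s) (nearest jk v s))
    (hdiff : DifferentiableAt ℝ (orthoProj jk) v) (k : Fin q × Fin m) (V : SymTuple q m) :
    ⟪tangentFrame ν (fun s a => gam s a.castSucc) k, fderiv ℝ (orthoProj jk) v V⟫ =
      2 * ((lam k.1 (Fin.last m) - lam k.1 k.2.castSucc)⁻¹ *
        bform (block V k.1) (gam k.1 k.2.castSucc) (ν k.1)) := by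
  have hlt := eigenvalue_lt_of_isNonfocal hv hgam
  have hνg : ∀ s, ν s = gam s (Fin.last m) ∨ ν s = -gam s (Fin.last m) := fun s =>
    eq_or_eq_neg_of_isNonfocal hv hgam hν s _ rfl
  have horth := inner_castSucc_eq_zero hνg
  obtain ⟨δ, hδ0, hδ⟩ := exists_gap (hlt k.1)
  -- Only block `k.1` matters, so the whole tuple may be negated to make its representative close to
  -- `ν`.
  have hrep : ∀ t : ℝ, ∃ h : Fin q → Vec m,
      (∀ s, IsUnitRep (h s) (nearest jk (v + t • V) s)) ∧ 0 ≤ ⟪ν k.1, h k.1⟫ := by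
    intro t
    choose h hh using fun s => exists_isUnitRep (nearest jk (v + t • V) s)
    rcases le_total 0 ⟪ν k.1, h k.1⟫ with h0 | h0
    · exact ⟨h, hh, h0⟩
    · exact ⟨fun s => -h s, fun s => (hh s).neg, by simpa using h0⟩
  choose h hh hsign using hrep
  set A : ℝ → Matrix (Fin (m + 1)) (Fin (m + 1)) ℝ := fun t => block (v + t • V) k.1
  have hA0 : ∀ a b, Tendsto (fun t => A t a b) (𝓝 0) (𝓝 (block v k.1 a b)) := by
    intro a b
    have : Continuous fun t => A t a b := by
      simp only [A, block_add_smul, Matrix.add_apply, Matrix.smul_apply]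
      fun_prop
    have := this.tendsto 0
    simpa [A] using this
  have hA : ∀ a b, Tendsto (fun t => A t a b) (𝓝[≠] 0) (𝓝 (block v k.1 a b)) := fun a b =>
    (hA0 a b).mono_left nhdsWithin_le_nhds
  have hmax : ∀ t x, ‖x‖ = 1 → bform (A t) x x ≤ bform (A t) (h t k.1) (h t k.1) := fun t x hx =>
    (isNearest_nearest _).rayleigh_max (hh t) k.1 hx
  have hlim : Tendsto (fun t => h t k.1) (𝓝[≠] 0) (𝓝 (ν k.1)) :=
    tendsto_of_rayleigh_max (hgam k.1) (block_isSymm v k.1) hδ0 hδ (hνg k.1) hA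
      (fun t => (hh t k.1).1) (fun t => hmax t _ (hν k.1).1) hsign
  have htop : Tendsto (fun t => bform (A t) (h t k.1) (h t k.1)) (𝓝[≠] 0)
      (𝓝 (lam k.1 (Fin.last m))) := by
    have h1 : bform (block v k.1) (ν k.1) (ν k.1) = lam k.1 (Fin.last m) := by
      rw [← (hgam k.1).bform_self (Fin.last m)]
      rcases hνg k.1 with h | h <;> rw [h]
      simp [bform]
    rw [← h1]
    exact tendsto_bform hA hlim hlim
  have hgapne : lam k.1 (Fin.last m) - lam k.1 k.2.castSucc ≠ 0 := (sub_pos.2 (hlt _ _)).ne'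
  have hVlim : Tendsto (fun t => bform (block V k.1) (gam k.1 k.2.castSucc) (h t k.1)) (𝓝[≠] 0)
      (𝓝 (bform (block V k.1) (gam k.1 k.2.castSucc) (ν k.1))) :=
    tendsto_bform (fun a b => tendsto_const_nhds) tendsto_const_nhds hlim
  have hinner : Tendsto (fun t => ⟪ν k.1, h t k.1⟫) (𝓝[≠] 0) (𝓝 1) := by
    have := (tendsto_const_nhds (x := ν k.1) (f := 𝓝[≠] (0 : ℝ))).inner (𝕜 := ℝ) hlim
    rwa [real_inner_self_eq_norm_sq, (hν k.1).1, one_pow] at this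
  have hΦ : ∀ t, ⟪tangentFrame ν (fun s a => gam s a.castSucc) k, orthoProj jk (v + t • V)⟫ =
      2 * (⟪gam k.1 k.2.castSucc, h t k.1⟫ * ⟪ν k.1, h t k.1⟫) := by
    intro t
    rw [inner_tangentFrame, orthoProj, block_jk (hh t)]
  have hΦ0 : ⟪tangentFrame ν (fun s a => gam s a.castSucc) k, orthoProj jk v⟫ = 0 := by
    rw [inner_tangentFrame, orthoProj, block_jk hν, horth]
    simp
  -- Pair the eigenvector equation of the perturbed matrix with `gam`, an eigenvector of the
  -- unperturbed one. This gives the difference quotient exactly, not just to first order.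
  have heig : ∀ t, (bform (A t) (h t k.1) (h t k.1) - lam k.1 k.2.castSucc) *
      ⟪gam k.1 k.2.castSucc, h t k.1⟫ =
        t * bform (block V k.1) (gam k.1 k.2.castSucc) (h t k.1) := by
    intro t
    have h1 : bform (A t) (gam k.1 k.2.castSucc) (h t k.1) =
        bform (A t) (h t k.1) (h t k.1) * ⟪gam k.1 k.2.castSucc, h t k.1⟫ := by
      conv_lhs => rw [bform, toEuclideanLin_eq_smul_of_rayleigh_max (block_isSymm _ k.1)
        (hh t k.1).1 (hmax t), real_inner_smul_right]
    have h2 : bform (A t) (gam k.1 k.2.castSucc) (h t k.1) =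
        bform (block v k.1) (gam k.1 k.2.castSucc) (h t k.1) +
          t * bform (block V k.1) (gam k.1 k.2.castSucc) (h t k.1) := by
      simp only [A, block_add_smul, bform_eq_sum, Matrix.add_apply, Matrix.smul_apply,
        smul_eq_mul, Finset.mul_sum, ← Finset.sum_add_distrib]
      exact Finset.sum_congr rfl fun a _ => Finset.sum_congr rfl fun b _ => by ring
    rw [bform_comm (block_isSymm v k.1), (hgam k.1).bform_right, real_inner_comm] at h2
    linarith
  have hquot : Tendsto (fun t : ℝ => t⁻¹ •
      (⟪tangentFrame ν (fun s a => gam s a.castSucc) k, orthoProj jk (v + t • V)⟫ -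
        ⟪tangentFrame ν (fun s a => gam s a.castSucc) k, orthoProj jk v⟫)) (𝓝[≠] 0)
      (𝓝 (2 * ((lam k.1 (Fin.last m) - lam k.1 k.2.castSucc)⁻¹ *
        bform (block V k.1) (gam k.1 k.2.castSucc) (ν k.1)))) := by
    have hden := htop.sub (tendsto_const_nhds (x := lam k.1 k.2.castSucc))
    have hprod := (((hden.inv₀ hgapne).mul hVlim).mul hinner).const_mul 2
    rw [mul_one] at hprod
    refine hprod.congr' ?_
    filter_upwards [hden.eventually_ne hgapne, self_mem_nhdsWithin] with t ht ht0
    have ht0' : t ≠ 0 := ht0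
    rw [hΦ, hΦ0, sub_zero, smul_eq_mul]
    have := heig t
    field_simp
    linear_combination (-⟪ν k.1, h t k.1⟫) * this
  -- Differentiability is a hypothesis, so the derivative is identified by its limit along one line.
  have hder : HasDerivAt (fun t : ℝ =>
      ⟪tangentFrame ν (fun s a => gam s a.castSucc) k, orthoProj jk (v + t • V)⟫)
      ⟪tangentFrame ν (fun s a => gam s a.castSucc) k, fderiv ℝ (orthoProj jk) v V⟫ 0 := by
    have hline : HasDerivAt (fun t : ℝ => v + t • V) V 0 := by
      simpa using ((hasDerivAt_id (0 : ℝ)).smul_const V).const_add v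
    have hF : HasFDerivAt (orthoProj jk) (fderiv ℝ (orthoProj jk) v) (v + (0 : ℝ) • V) := by
      simpa using hdiff.hasFDerivAt
    have hc := hF.comp_hasDerivAt (0 : ℝ) hline
    have := (hasDerivAt_const (0 : ℝ) (tangentFrame ν (fun s a => gam s a.castSucc) k)).inner ℝ hc
    simpa using this
  have hslope := hasDerivAt_iff_tendsto_slope_zero.1 hder
  simp only [zero_add, zero_smul, add_zero] at hslope
  exact tendsto_nhds_unique hslope hquot

end Nonfocal

/-! ### Regularity of the embedding -/

section Measurability

variable {q m : ℕ}

instance instBorelSpaceRP (m : ℕ) : BorelSpace (RP m) := ⟨rfl⟩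

/-- On nonzero vectors this is a continuous function, homogeneous of degree 0, so it descends to the
quotient topology. -/
theorem continuous_jEntry (a b : Fin (m + 1)) : Continuous fun p : RP m => jEntry p a b := by
  refine continuous_coinduced_dom.2 ?_
  have h : ((fun p : RP m => jEntry p a b) ∘ fun v : {v : Vec m // v ≠ 0} =>
      Projectivization.mk' ℝ v) = fun v => v.1 a * v.1 b / ‖v.1‖ ^ 2 := by
    funext v
    have hn : ‖v.1‖ ≠ 0 := norm_ne_zero_iff.2 v.2
    have hrep : IsUnitRep (‖v.1‖⁻¹ • v.1) (Projectivization.mk' ℝ v) := by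
      refine ⟨by rw [norm_smul, norm_inv, norm_norm, inv_mul_cancel₀ hn],
        smul_ne_zero (inv_ne_zero hn) v.2, ?_⟩
      exact (Projectivization.mk_eq_mk_iff' ℝ _ _ _ _).2 ⟨‖v.1‖⁻¹, rfl⟩
    simp only [Function.comp_apply, jEntry_eq hrep, PiLp.smul_apply, smul_eq_mul]
    field_simp
  rw [h]
  refine Continuous.div (by fun_prop) (by fun_prop) fun v => ?_
  exact pow_ne_zero 2 (norm_ne_zero_iff.2 v.2)

theorem abs_jEntry_le (p : RP m) (a b : Fin (m + 1)) : |jEntry p a b| ≤ 1 := by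
  obtain ⟨x, hx⟩ := exists_isUnitRep p
  rw [jEntry_eq hx, abs_mul]
  have h : ∀ a, |x a| ≤ 1 := fun a => by rw [← hx.1]; exact PiLp.norm_apply_le x a
  exact mul_le_one₀ (h a) (abs_nonneg _) (h b)

theorem measurable_jk : Measurable (jk : (Fin q → RP m) → SymTuple q m) := by
  refine Measurable.subtype_mk ?_
  refine (WithLp.measurable_toLp 2 _).comp (measurable_pi_lambda _ fun i => ?_)
  exact (continuous_jEntry i.2.1 i.2.2).measurable.comp (measurable_pi_apply i.1)

theorem norm_jk (p : Fin q → RP m) : ‖jk p‖ = √q := by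
  rw [← norm_sq_jk p, Real.sqrt_sq (norm_nonneg _)]

end Measurability

/-! ### Population scores and the extrinsic covariance -/

section Population

variable {Ω : Type*} [MeasurableSpace Ω] {P : Measure Ω} {q m : ℕ} {Y : Ω → Fin q → RP m}

theorem integrable_jk [IsFiniteMeasure P] (hY : Measurable Y) :
    Integrable (fun ω => jk (Y ω)) P :=
  Integrable.of_bound (measurable_jk.comp hY).aestronglyMeasurable (√q)
    (Eventually.of_forall fun ω => (norm_jk (Y ω)).le)

theorem block_meanVector [IsFiniteMeasure P] (hY : Measurable Y) {X : Ω → Fin q → Vec m}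
    (hX : ∀ ω s, IsUnitRep (X ω s) (Y ω s)) (s : Fin q) :
    block (meanVector jk Y P) s = secondMoment P fun ω => X ω s := by
  ext a b
  let L : SymTuple q m →L[ℝ] ℝ := (EuclideanSpace.proj (s, a, b)).comp (SymTuple q m).subtypeL
  have h : L (∫ ω, jk (Y ω) ∂P) = ∫ ω, L (jk (Y ω)) ∂P :=
    (L.integral_comp_comm (integrable_jk hY)).symm
  refine h.trans ?_
  simp only [secondMoment, Matrix.of_apply]
  exact integral_congr_ae (Eventually.of_forall fun ω => jk_apply (hX ω) s a b)

/-- The score vector as a function of the point of `(ℝPᵐ)^q`. -/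
noncomputable def scoreMap (gam : Fin q → OrthonormalBasis (Fin (m + 1)) ℝ (Vec m))
    (ν : Fin q → Vec m) (p : Fin q → RP m) : EuclideanSpace ℝ (Fin q × Fin m) :=
  WithLp.toLp 2 fun i => bform (block (jk p) i.1) (gam i.1 i.2.castSucc) (ν i.1)

variable {gam : Fin q → OrthonormalBasis (Fin (m + 1)) ℝ (Vec m)} {ν : Fin q → Vec m}

theorem scoreMap_eq_score {p : Fin q → RP m} {x : Fin q → Vec m}
    (hx : ∀ s, IsUnitRep (x s) (p s)) : (scoreMap gam ν p).ofLp = score gam ν x := by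
  funext i
  exact block_jk hx i.1 _ _

theorem scoreMap_apply (p : Fin q → RP m) (i : Fin q × Fin m) :
    scoreMap gam ν p i =
      2⁻¹ * ⟪tangentFrame ν (fun s a => gam s a.castSucc) i, jk p⟫ := by
  rw [inner_tangentFrame]
  simp [scoreMap]

theorem measurable_scoreMap : Measurable (scoreMap gam ν) := by
  refine (WithLp.measurable_toLp 2 _).comp (measurable_pi_lambda _ fun i => ?_)
  change Measurable fun p => scoreMap gam ν p i
  simp only [scoreMap_apply]
  exact (measurable_const.inner measurable_jk).const_mul _

theorem memLp_scoreMap [IsFiniteMeasure P] (hY : Measurable Y) (hν : ∀ s, ‖ν s‖ = 1) :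
    MemLp (fun ω => scoreMap gam ν (Y ω)) 2 P := by
  refine MemLp.of_bound (measurable_scoreMap.comp hY).aestronglyMeasurable
    (√(Fintype.card (Fin q × Fin m))) (Eventually.of_forall fun ω => ?_)
  choose x hx using fun s => exists_isUnitRep (Y ω s)
  rw [EuclideanSpace.norm_eq]
  refine Real.sqrt_le_sqrt ?_
  have h : ∀ i, ‖scoreMap gam ν (Y ω) i‖ ^ 2 ≤ 1 := by
    intro i
    have h1 := abs_real_inner_le_norm (gam i.1 i.2.castSucc) (x i.1)
    have h2 := abs_real_inner_le_norm (ν i.1) (x i.1)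
    rw [(gam i.1).norm_eq_one, (hx i.1).1, one_mul] at h1
    rw [hν, (hx i.1).1, one_mul] at h2
    rw [scoreMap_eq_score hx, score, Real.norm_eq_abs, abs_mul]
    exact pow_le_one₀ (by positivity) (mul_le_one₀ h1 (abs_nonneg _) h2)
  calc ∑ i, ‖scoreMap gam ν (Y ω) i‖ ^ 2 ≤ ∑ i : Fin q × Fin m, (1 : ℝ) :=
        Finset.sum_le_sum fun i _ => h i
    _ = _ := by simp

theorem integral_scoreMap [IsFiniteMeasure P] (hY : Measurable Y) (i : Fin q × Fin m) :
    ∫ ω, scoreMap gam ν (Y ω) i ∂P =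
      bform (block (meanVector jk Y P) i.1) (gam i.1 i.2.castSucc) (ν i.1) := by
  simp only [scoreMap_apply]
  rw [integral_const_mul, integral_inner (integrable_jk hY), ← meanVector, inner_tangentFrame]
  simp

variable {lam : Fin q → Fin (m + 1) → ℝ}

/-- The second moment matrix of the score vector. -/
noncomputable def scoreSigma (P : Measure Ω) (Y : Ω → Fin q → RP m)
    (gam : Fin q → OrthonormalBasis (Fin (m + 1)) ℝ (Vec m)) (ν : Fin q → Vec m) :
    Matrix (Fin q × Fin m) (Fin q × Fin m) ℝ :=
  Matrix.of fun i k => ∫ ω, scoreMap gam ν (Y ω) i * scoreMap gam ν (Y ω) k ∂P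

/-- The extrinsic covariance is the score matrix conjugated by the invertible diagonal matrix of
inverse gaps. -/
theorem scoreSigma_posDef [IsProbabilityMeasure P] (hY : Measurable Y)
    (hnf : NonfocalObject jk Y P)
    (hgam : ∀ s, IsOrderedEigensystem (block (meanVector jk Y P) s) (lam s) (gam s))
    (hν : ∀ s, IsUnitRep (ν s) (extrinsicMean jk Y P s))
    (hcov : (extrinsicCov jk Y P (tangentFrame ν fun s a => gam s a.castSucc)).PosDef) :
    (scoreSigma P Y gam ν).PosDef := by
  have hlt := eigenvalue_lt_of_isNonfocal hnf hgam
  have hνg : ∀ s, ν s = gam s (Fin.last m) ∨ ν s = -gam s (Fin.last m) := fun s =>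
    eq_or_eq_neg_of_isNonfocal hnf hgam hν s _ rfl
  have horth := inner_castSucc_eq_zero hνg
  rcases isEmpty_or_nonempty (Fin q × Fin m) with hI | ⟨⟨i₀⟩⟩
  · exact (Subsingleton.elim (extrinsicCov jk Y P _) (scoreSigma P Y gam ν)) ▸ hcov
  -- At a point of non-differentiability `fderiv` is 0, and the covariance matrix would have a zero
  -- diagonal; positive definiteness thus supplies differentiability.
  have hdiff : DifferentiableAt ℝ (orthoProj jk) (meanVector jk Y P) := by
    by_contra hd
    have h := hcov.diag_pos (i := i₀)
    simp [extrinsicCov, fderiv_zero_of_not_differentiableAt hd, covariance] at h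
  set c : Fin q × Fin m → ℝ := fun i => (lam i.1 (Fin.last m) - lam i.1 i.2.castSucc)⁻¹
  have hc : ∀ i, c i ≠ 0 := fun i => inv_ne_zero (sub_pos.2 (hlt i.1 i.2)).ne'
  have hmean : ∀ i, ∫ ω, scoreMap gam ν (Y ω) i ∂P = 0 := by
    intro i
    rw [integral_scoreMap hY, bform_comm (block_isSymm _ i.1), (hgam i.1).bform_right,
      real_inner_comm, horth, mul_zero]
  have hlp := memLp_scoreMap (P := P) (gam := gam) hY fun s => (hν s).1
  have hcoord : ∀ i, MemLp (fun ω => scoreMap gam ν (Y ω) i) 2 P := fun i =>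
    (EuclideanSpace.proj (𝕜 := ℝ) i).comp_memLp' hlp
  have hEq : extrinsicCov jk Y P (tangentFrame ν fun s a => gam s a.castSucc) =
      Matrix.diagonal c * scoreSigma P Y gam ν * star (Matrix.diagonal c) := by
    have hZ : ∀ (i : Fin q × Fin m) ω, ⟪tangentFrame ν (fun s a => gam s a.castSucc) i,
        fderiv ℝ (orthoProj jk) (meanVector jk Y P) (jk (Y ω))⟫ /
        ⟪tangentFrame ν (fun s a => gam s a.castSucc) i,
          tangentFrame ν (fun s a => gam s a.castSucc) i⟫ = c i * scoreMap gam ν (Y ω) i := by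
      intro i ω
      -- The frame vectors have squared norm 2, cancelling the factor 2 from pairing with a
      -- symmetric matrix.
      have hself := inner_tangentFrame_self (w := fun s (a : Fin m) => gam s a.castSucc) (k := i)
        (hν i.1).1 ((gam i.1).norm_eq_one _) (horth i.1 i.2)
      rw [hself, inner_tangentFrame_fderiv hnf hgam hν hdiff i (jk (Y ω))]
      exact mul_div_cancel_left₀ _ two_ne_zero
    ext i k
    simp only [extrinsicCov, Matrix.of_apply, hZ]
    rw [covariance_const_mul_left, covariance_const_mul_right,
      covariance_eq_sub (hcoord i) (hcoord k), hmean, Matrix.star_eq_conjTranspose,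
      Matrix.diagonal_conjTranspose, Matrix.mul_diagonal, Matrix.diagonal_mul]
    simp [scoreSigma]
    ring
  rw [hEq] at hcov
  refine (Matrix.IsUnit.posDef_star_right_conjugate_iff ?_).1 hcov
  rw [Matrix.isUnit_iff_isUnit_det, Matrix.det_diagonal, isUnit_iff_ne_zero]
  exact Finset.prod_ne_zero_iff.2 fun i _ => hc i

theorem scoreSigma_eq_sum [IsFiniteMeasure P] (hY : Measurable Y) :
    scoreSigma P Y gam ν = Matrix.of fun i k => ∑ a, ∑ b, ∑ c, ∑ e,
      (gam i.1 i.2.castSucc a * ν i.1 b * gam k.1 k.2.castSucc c * ν k.1 e) *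
        ∫ ω, jEntry (Y ω i.1) a b * jEntry (Y ω k.1) c e ∂P := by
  ext i k
  have hint : ∀ a b c e,
      Integrable (fun ω => jEntry (Y ω i.1) a b * jEntry (Y ω k.1) c e) P := by
    intro a b c e
    refine Integrable.of_bound (C := 1) (Measurable.aestronglyMeasurable ?_)
      (Eventually.of_forall fun ω => ?_)
    · exact ((continuous_jEntry a b).measurable.comp ((measurable_pi_apply i.1).comp hY)).mul
        ((continuous_jEntry c e).measurable.comp ((measurable_pi_apply k.1).comp hY))
    · rw [Real.norm_eq_abs, abs_mul]
      exact mul_le_one₀ (abs_jEntry_le _ _ _) (abs_nonneg _) (abs_jEntry_le _ _ _)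
  have h : ∀ ω, scoreMap gam ν (Y ω) i * scoreMap gam ν (Y ω) k = ∑ a, ∑ b, ∑ c, ∑ e,
      (gam i.1 i.2.castSucc a * ν i.1 b * gam k.1 k.2.castSucc c * ν k.1 e) *
        (jEntry (Y ω i.1) a b * jEntry (Y ω k.1) c e) := by
    intro ω
    choose x hx using fun s => exists_isUnitRep (Y ω s)
    simp only [scoreMap_eq_score hx, score, inner_mul_inner_mul_eq_sum, jEntry_eq (hx _)]
  simp only [scoreSigma, Matrix.of_apply, h]
  rw [integral_finsetSum _ fun a _ => integrable_finsetSum _ fun b _ =>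
    integrable_finsetSum _ fun c _ => integrable_finsetSum _ fun e _ =>
      (hint a b c e).const_mul _]
  refine Finset.sum_congr rfl fun a _ => ?_
  rw [integral_finsetSum _ fun b _ => integrable_finsetSum _ fun c _ =>
    integrable_finsetSum _ fun e _ => (hint a b c e).const_mul _]
  refine Finset.sum_congr rfl fun b _ => ?_
  rw [integral_finsetSum _ fun c _ => integrable_finsetSum _ fun e _ =>
    (hint a b c e).const_mul _]
  refine Finset.sum_congr rfl fun c _ => ?_
  rw [integral_finsetSum _ fun e _ => (hint a b c e).const_mul _]
  exact Finset.sum_congr rfl fun e _ => integral_const_mul _ _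

end Population

/-! ### Measurability of the sample quantities -/

section SampleMeasurability

variable {Ω : Type*} [MeasurableSpace Ω] {q m : ℕ} {X : ℕ → Ω → Fin q → Vec m}
  {g : Ω → Fin q → OrthonormalBasis (Fin (m + 1)) ℝ (Vec m)}

theorem measurable_bform {A : Ω → Matrix (Fin (m + 1)) (Fin (m + 1)) ℝ} {u v : Ω → Vec m}
    (hA : ∀ a b, Measurable fun ω => A ω a b) (hu : Measurable u) (hv : Measurable v) :
    Measurable fun ω => bform (A ω) (u ω) (v ω) := by
  simp only [bform_eq_sum]
  have hc : ∀ a : Fin (m + 1), Measurable fun x : Vec m => x a := fun a => by fun_prop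
  exact Finset.measurable_fun_sum _ fun a _ => Finset.measurable_fun_sum _ fun b _ =>
    (((hc a).comp hu).mul (hA a b)).mul ((hc b).comp hv)

theorem measurable_inner_mul_inner_mul
    (hX : ∀ r s a b, Measurable fun ω => X r ω s a * X r ω s b)
    {u v w z : Ω → Vec m} (hu : Measurable u) (hv : Measurable v) (hw : Measurable w)
    (hz : Measurable z) (r : ℕ) (s t : Fin q) :
    Measurable fun ω => (⟪u ω, X r ω s⟫ * ⟪v ω, X r ω s⟫) * (⟪w ω, X r ω t⟫ * ⟪z ω, X r ω t⟫) := by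
  simp only [inner_mul_inner_mul_eq_sum]
  have hc : ∀ a : Fin (m + 1), Measurable fun x : Vec m => x a := fun a => by fun_prop
  exact Finset.measurable_fun_sum _ fun a _ => Finset.measurable_fun_sum _ fun b _ =>
    Finset.measurable_fun_sum _ fun c _ => Finset.measurable_fun_sum _ fun e _ =>
      (((((hc a).comp hu).mul ((hc b).comp hv)).mul ((hc c).comp hw)).mul ((hc e).comp hz)).mul
        ((hX r s a b).mul (hX r t c e))

theorem measurable_scoreCov (hX : ∀ r s a b, Measurable fun ω => X r ω s a * X r ω s b)
    (gam : Fin q → OrthonormalBasis (Fin (m + 1)) ℝ (Vec m)) {h : Ω → Fin q → Vec m}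
    (hh : ∀ s, Measurable fun ω => h ω s) (n : ℕ) (i k : Fin q × Fin m) :
    Measurable fun ω => scoreCov n gam (fun r => X r ω) (h ω) i k := by
  have hp : ∀ i : Fin q × Fin m, Measurable fun ω =>
      gam i.1 i.2.castSucc - ⟪gam i.1 i.2.castSucc, h ω i.1⟫ • h ω i.1 := fun i =>
    measurable_const.sub (Measurable.smul (f := fun ω => ⟪gam i.1 i.2.castSucc, h ω i.1⟫)
      (measurable_const.inner (hh i.1)) (hh i.1))
  simp only [scoreCov, Matrix.smul_apply, Matrix.sum_apply, Matrix.vecMulVec_apply, projScore,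
    smul_eq_mul]
  exact (Finset.measurable_fun_sum _ fun r _ =>
    measurable_inner_mul_inner_mul hX (hp i) (hh i.1) (hp k) (hh k.1) r i.1 k.1).const_mul _

theorem measurable_hotelling (hX : ∀ r s a b, Measurable fun ω => X r ω s a * X r ω s b)
    {n : ℕ} {d : Ω → Fin q → Fin (m + 1) → ℝ}
    (hg : ∀ ω s, IsOrderedEigensystem (sampleMoment n (fun r => X r ω) s) (d ω s) (g ω s))
    (hgmeas : ∀ s a, Measurable fun ω => g ω s a) (ν : Fin q → Vec m) :
    Measurable fun ω => hotelling n (fun r => X r ω) (d ω) (g ω) ν := by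
  have hJ : ∀ s a b, Measurable fun ω => sampleMoment n (fun r => X r ω) s a b := fun s a b => by
    simp only [sampleMoment, Matrix.of_apply]
    exact (Finset.measurable_fun_sum _ fun r _ => hX r s a b).const_mul _
  -- Eigenvalues inherit measurability as Rayleigh quotients of the measurable eigenvectors.
  have hd : ∀ s a, Measurable fun ω => d ω s a := fun s a => by
    simp only [← (hg _ s).bform_self a]
    exact measurable_bform (hJ s) (hgmeas s a) (hgmeas s a)
  have hdev : ∀ i, Measurable fun ω => deviation (g ω) ν i := fun i =>
    measurable_const.inner (hgmeas i.1 i.2.castSucc)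
  have hG : ∀ i k, Measurable fun ω => sampleCov n (fun r => X r ω) (d ω) (g ω) i k := by
    intro i k
    have h : ∀ ω r, ⟪g ω i.1 i.2.castSucc, X r ω i.1⟫ * ⟪g ω k.1 k.2.castSucc, X r ω k.1⟫ *
        ⟪g ω i.1 (Fin.last m), X r ω i.1⟫ * ⟪g ω k.1 (Fin.last m), X r ω k.1⟫ =
        (⟪g ω i.1 i.2.castSucc, X r ω i.1⟫ * ⟪g ω i.1 (Fin.last m), X r ω i.1⟫) *
        (⟪g ω k.1 k.2.castSucc, X r ω k.1⟫ * ⟪g ω k.1 (Fin.last m), X r ω k.1⟫) :=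
      fun ω r => by ring
    simp only [sampleCov, Matrix.of_apply, h]
    refine (((((hd _ _).sub (hd _ _)).inv.const_mul _)).mul ((hd _ _).sub (hd _ _)).inv).mul ?_
    exact Finset.measurable_fun_sum _ fun r _ => measurable_inner_mul_inner_mul hX
      (hgmeas _ _) (hgmeas _ _) (hgmeas _ _) (hgmeas _ _) r i.1 k.1
  simp only [hotelling, dotProduct, Matrix.mulVec]
  exact (Finset.measurable_fun_sum _ fun i _ => (hdev i).mul
    (Finset.measurable_fun_sum _ fun k _ =>
      (measurable_matrix_inv hG i k).mul (hdev k))).const_mul _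

end SampleMeasurability

/-- The strong law of large numbers for a bounded measurable function of the observations. -/
theorem ae_tendsto_average {Ω E : Type*} [MeasurableSpace Ω] [MeasurableSpace E] {P : Measure Ω}
    [IsProbabilityMeasure P] {Y : ℕ → Ω → E} (hYmeas : ∀ r, Measurable (Y r))
    (hYindep : iIndepFun Y P) (hYident : ∀ r, IdentDistrib (Y r) (Y 0) P P) {f : E → ℝ}
    (hf : Measurable f) {C : ℝ} (hC : ∀ y, |f y| ≤ C) :
    ∀ᵐ ω ∂P, Tendsto (fun n : ℕ => (n : ℝ)⁻¹ * ∑ r ∈ Finset.range n, f (Y r ω)) atTop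
      (𝓝 (∫ ω, f (Y 0 ω) ∂P)) :=
  strong_law_ae (fun r ω => f (Y r ω))
    (Integrable.of_bound (hf.comp (hYmeas 0)).aestronglyMeasurable C
      (Eventually.of_forall fun _ => hC _))
    (fun _ _ hij => (hYindep.indepFun hij).comp hf hf) fun r => (hYident r).comp hf

end ProjectiveShape

/-! ### The chi-square limit -/

theorem theorem4p1 {Ω : Type*} [MeasurableSpace Ω] (P : Measure Ω) [IsProbabilityMeasure P]
    (m q : ℕ)
    -- the i.i.d. random objects `Y_r` and unit representatives `X_r^s` of their components
    (Y : ℕ → Ω → Fin q → ProjectiveShape.RP m) (X : ℕ → Ω → Fin q → ProjectiveShape.Vec m)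
    (hYmeas : ∀ r, Measurable (Y r))
    (hYindep : iIndepFun Y P)
    (hYident : ∀ r, IdentDistrib (Y r) (Y 0) P P)
    (hX : ∀ r ω s, ProjectiveShape.IsUnitRep (X r ω s) (Y r ω s))
    (hnonfocal : ProjectiveShape.NonfocalObject ProjectiveShape.jk (Y 0) P)
    -- eigenvalues and eigenvectors of the matrices `E (X^s (X^s)ᵀ)`
    (lam : Fin q → Fin (m + 1) → ℝ)
    (gam : Fin q → OrthonormalBasis (Fin (m + 1)) ℝ (ProjectiveShape.Vec m))
    (hgam : ∀ s, ProjectiveShape.IsOrderedEigensystem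
      (ProjectiveShape.secondMoment P fun ω => X 0 ω s) (lam s) (gam s))
    (hlam : ∀ s, 0 < lam s 0)
    -- unit representatives of the extrinsic mean
    (ν : Fin q → ProjectiveShape.Vec m)
    (hν : ∀ s, ProjectiveShape.IsUnitRep (ν s)
      (ProjectiveShape.extrinsicMean ProjectiveShape.jk (Y 0) P s))
    -- the extrinsic covariance matrix is nondegenerate
    (hcov : (ProjectiveShape.extrinsicCov ProjectiveShape.jk (Y 0) P
      (ProjectiveShape.tangentFrame ν fun s a => gam s a.castSucc)).PosDef)
    -- eigenvalues and eigenvectors of the sample matrices `J_s`, the sign of the top eigenvector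
    -- being chosen so that it points to the same side as `ν_s`
    (d : ℕ → Ω → Fin q → Fin (m + 1) → ℝ)
    (g : ℕ → Ω → Fin q → OrthonormalBasis (Fin (m + 1)) ℝ (ProjectiveShape.Vec m))
    (hg : ∀ n ω s, ProjectiveShape.IsOrderedEigensystem
      (ProjectiveShape.sampleMoment n (fun r => X r ω) s) (d n ω s) (g n ω s))
    (hgmeas : ∀ n s a, Measurable fun ω => g n ω s a)
    (hsign : ∀ n ω s, 0 ≤ inner ℝ (ν s) (g n ω s (Fin.last m))) :
    TendstoInDistribution
      (fun n ω => ProjectiveShape.hotelling n (fun r => X r ω) (d n ω) (g n ω) ν)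
      atTop (id : ℝ → ℝ) (fun _ => P) (ProjectiveShape.chiSq (m * q)) := by
  have hgam' : ∀ s, ProjectiveShape.IsOrderedEigensystem (ProjectiveShape.block
      (ProjectiveShape.meanVector ProjectiveShape.jk (Y 0) P) s) (lam s) (gam s) := fun s => by
    rw [ProjectiveShape.block_meanVector (hYmeas 0) (hX 0)]; exact hgam s
  have hcovSigma := ProjectiveShape.scoreSigma_posDef (hYmeas 0) hnonfocal hgam' hν hcov
  have hlt := ProjectiveShape.eigenvalue_lt_of_isNonfocal hnonfocal hgam'
  have hνg : ∀ s, ν s = gam s (Fin.last m) ∨ ν s = -gam s (Fin.last m) := fun s =>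
    ProjectiveShape.eq_or_eq_neg_of_isNonfocal hnonfocal hgam' hν s _ rfl
  have horth := ProjectiveShape.inner_castSucc_eq_zero hνg
  have hsymm : ∀ s, (ProjectiveShape.secondMoment P fun ω => X 0 ω s).IsSymm := fun s => by
    rw [← ProjectiveShape.block_meanVector (hYmeas 0) (hX 0)]
    exact ProjectiveShape.block_isSymm _ s
  have hjmeas : ∀ s a b, Measurable fun p : Fin q → ProjectiveShape.RP m =>
      ProjectiveShape.jEntry (p s) a b := fun s a b =>
    (ProjectiveShape.continuous_jEntry a b).measurable.comp (measurable_pi_apply s)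
  have hXj : ∀ r ω s a b, X r ω s a * X r ω s b = ProjectiveShape.jEntry (Y r ω s) a b :=
    fun r ω s a b => (ProjectiveShape.jEntry_eq (hX r ω s) a b).symm
  -- The representatives may have arbitrary, non-measurable signs; only these sign-free products are
  -- used.
  have hXmeas : ∀ r s a b, Measurable fun ω => X r ω s a * X r ω s b := fun r s a b => by
    simp only [hXj]
    exact (hjmeas s a b).comp (hYmeas r)
  have hmean : ∀ i, ∫ ω, ProjectiveShape.scoreMap gam ν (Y 0 ω) i ∂P = 0 := fun i => by
    rw [ProjectiveShape.integral_scoreMap (hYmeas 0),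
      ProjectiveShape.bform_comm (ProjectiveShape.block_isSymm _ i.1), (hgam' i.1).bform_right,
      real_inner_comm, horth, mul_zero]
  have hclt := ProjectiveShape.tendstoInDistribution_multivariateGaussian
    (V := fun r ω => ProjectiveShape.scoreMap gam ν (Y r ω))
    (ProjectiveShape.memLp_scoreMap (hYmeas 0) fun s => (hν s).1) hmean
    (hYindep.comp (fun _ => ProjectiveShape.scoreMap gam ν)
      fun _ => ProjectiveShape.measurable_scoreMap)
    fun r => (hYident r).comp ProjectiveShape.measurable_scoreMap
  have hJ : ∀ᵐ ω ∂P, ∀ s a b, Tendsto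
      (fun n => ProjectiveShape.sampleMoment n (fun r => X r ω) s a b) atTop
      (𝓝 (ProjectiveShape.secondMoment P (fun ω => X 0 ω s) a b)) := by
    simp only [ae_all_iff]
    intro s a b
    have h := ProjectiveShape.ae_tendsto_average hYmeas hYindep hYident (hjmeas s a b)
      fun p => ProjectiveShape.abs_jEntry_le (p s) a b
    simp only [ProjectiveShape.sampleMoment, ProjectiveShape.secondMoment, Matrix.of_apply, hXj]
    exact h
  have hM : ∀ᵐ ω ∂P, ∀ s t a b c e, Tendsto (fun n : ℕ => (n : ℝ)⁻¹ * ∑ r ∈ Finset.range n,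
      (X r ω s a * X r ω s b) * (X r ω t c * X r ω t e)) atTop
      (𝓝 (∫ ω, ProjectiveShape.jEntry (Y 0 ω s) a b *
        ProjectiveShape.jEntry (Y 0 ω t) c e ∂P)) := by
    simp only [ae_all_iff]
    intro s t a b c e
    have h := ProjectiveShape.ae_tendsto_average hYmeas hYindep hYident
      ((hjmeas s a b).mul (hjmeas t c e)) (C := 1) fun p => by
        rw [Pi.mul_apply, abs_mul]
        exact mul_le_one₀ (ProjectiveShape.abs_jEntry_le _ _ _) (abs_nonneg _)
          (ProjectiveShape.abs_jEntry_le _ _ _)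
    simp only [hXj]
    exact h
  have htop : ∀ᵐ ω ∂P, ∀ s, Tendsto (fun n => g n ω s (Fin.last m)) atTop (𝓝 (ν s)) := by
    filter_upwards [hJ] with ω hω s
    obtain ⟨δ, hδ0, hδ⟩ := ProjectiveShape.exists_gap (hlt s)
    refine ProjectiveShape.tendsto_of_rayleigh_max (hgam s) (hsymm s) hδ0 hδ (hνg s) (hω s)
      -- The top sample eigenvector maximizes the Rayleigh quotient of `J_s`, in particular it beats
      -- `ν s`.
      (fun n => (g n ω s).norm_eq_one _) (fun n => ?_) fun n => hsign n ω s
    rw [(hg n ω s).bform_self]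
    exact (hg n ω s).bform_le (ProjectiveShape.sampleMoment_isSymm _ _ _) (hν s).1
  have hK : ∀ᵐ ω ∂P, Tendsto (fun n => ProjectiveShape.scoreCov n gam (fun r => X r ω)
      fun s => g n ω s (Fin.last m)) atTop
      (𝓝 (ProjectiveShape.scoreSigma P (Y 0) gam ν)) := by
    rw [ProjectiveShape.scoreSigma_eq_sum (hYmeas 0)]
    filter_upwards [hM, htop] with ω hω1 hω2
    exact ProjectiveShape.tendsto_scoreCov horth (x := fun r => X r ω)
      (h := fun n s => g n ω s (Fin.last m)) hω2
      (μ := fun s t a b c e => ∫ ω, ProjectiveShape.jEntry (Y 0 ω s) a b *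
        ProjectiveShape.jEntry (Y 0 ω t) c e ∂P) hω1
  refine ProjectiveShape.tendstoInDistribution_chiSq hcovSigma
    (K := fun n ω => ProjectiveShape.scoreCov n gam (fun r => X r ω)
      fun s => g n ω s (Fin.last m))
    (by simp [mul_comm]) hclt
    (fun n => ProjectiveShape.measurable_scoreCov hXmeas gam (fun s => hgmeas n s _) n) hK
    (fun n => (ProjectiveShape.measurable_hotelling hXmeas (hg n) (hgmeas n) ν).aemeasurable) ?_
  -- Almost surely, gaps are positive and the score matrix is invertible for all large `n`, so the
  -- values of the statistic in degenerate cases do not affect the limit.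
  filter_upwards [hJ, htop, hK] with ω hω1 hω2 hω3
  have hgap : ∀ᶠ n in atTop, ∀ s (a : Fin m), d n ω s a.castSucc < d n ω s (Fin.last m) := by
    refine eventually_all.2 fun s => ?_
    obtain ⟨δ, hδ0, hδ⟩ := ProjectiveShape.exists_gap (hlt s)
    exact ProjectiveShape.eventually_eigenvalue_lt (hgam s) (hsymm s) hδ0 hδ (hνg s) (hω1 s)
      (fun n => hg n ω s) (hω2 s)
  have hdet : ∀ᶠ n in atTop, (ProjectiveShape.scoreCov n gam (fun r => X r ω)
      fun s => g n ω s (Fin.last m)).det ≠ 0 :=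
    (((Continuous.matrix_det continuous_id).tendsto _).comp hω3).eventually_ne
      hcovSigma.det_pos.ne'
  filter_upwards [hgap, hdet] with n hn1 hn2
  rw [ProjectiveShape.hotelling_eq (hg n ω) horth hn1 hn2]
  have hV : (((√n)⁻¹ • ∑ r ∈ Finset.range n, ProjectiveShape.scoreMap gam ν (Y r ω) :
      EuclideanSpace ℝ (Fin q × Fin m))).ofLp =
      (√n)⁻¹ • ∑ r ∈ Finset.range n, ProjectiveShape.score gam ν (X r ω) := by
    rw [WithLp.ofLp_smul, WithLp.ofLp_sum]
    simp only [ProjectiveShape.scoreMap_eq_score (hX _ ω)]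
  rw [hV]
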